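/- For a Hermitian matrix $A\in\mathbb C^{d\times d}$ let $\mathrm{spec}(A)$ be the vector of its eigenvalues, with multiplicity, sorted from largest to smallest, let $\mathrm{spec}(A)_{\le r}$ be the vector of the first $r$ of them, and let $\|A\|_\infty$ be the operator norm. For real vectors $x,y$ of the same length let $d_{\mathrm{TV}}(x,y)=\frac12\sum_i|x_i-y_i|$. A $d$-dimensional state is a positive semidefinite matrix $\rho\in\mathbb C^{d\times d}$ of trace $1$. Measuring $\rho$ with the uniform POVM yields a random unit vector $u\in\mathbb C^d$ with density $d\cdot\mathrm{tr}(|u\rangle\langle u|\,\rho)$ with respect to the unitarily invariant probability measure on the unit sphere of $\mathbb C^d$. Given a threshold $B$, the uniform POVM bucketing algorithm measures each of $n$ copies of $\rho$ independently with the uniform POVM, obtaining $u_1,\dots,u_n$, sets $$\hat\rho=\frac1n\sum_{i=1}^n\bigl((d+1)|u_i\rangle\langle u_i|-I\bigr),$$ and lets $\Pi$ be the orthogonal projector onto the span of the eigenvectors of $\hat\rho$ with eigenvalue at least $B$. Write $\bar\Pi=I-\Pi$ and $r=\mathrm{rank}(\Pi)$. **Theorem.** There is a universal constant $C>0$ such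 that for every $d$, every $d$-dimensional state $\rho$, all $0<B\le1$ and $0<\varepsilon\le1$, and every integer $n\ge C\,d\,B^{-2}\varepsilon^{-2}$, with probability at least $0.99$ the following hold simultaneously: 1. $d_{\mathrm{TV}}\bigl(\mathrm{spec}(\hat\rho)_{\le r},\mathrm{spec}(\rho)_{\le r}\bigr)\le\varepsilon$ and $r\le\frac{3}{2B}$; 2. $\|\bar\Pi\rho\bar\Pi\|_\infty\le(1+\varepsilon)B$; 3. $d_{\mathrm{TV}}\bigl(\mathrm{spec}(\Pi\rho\Pi+\bar\Pi\rho\bar\Pi),\mathrm{spec}(\rho)\bigr)\le\varepsilon$. -/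

import Mathlib

open MeasureTheory
open scoped ENNReal ComplexOrder

namespace UniformPOVM

noncomputable section

/-- A density matrix (mixed state) on `ℂ^d`: positive semidefinite with trace one. -/
structure IsDensityMatrix {d : ℕ} (ρ : Matrix (Fin d) (Fin d) ℂ) : Prop where
  posSemidef : ρ.PosSemidef
  trace_eq_one : ρ.trace = 1

/-- Total variation distance of two real vectors: half of the `ℓ¹` distance. -/
def dTV {ι : Type*} [Fintype ι] (x y : ι → ℝ) : ℝ :=
  (1 / 2) * ∑ i, |x i - y i|

/-- Operator norm (Schatten `∞`-norm) of a matrix acting on the Hilbert space `ℂ^d`. -/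
def opNorm {d : ℕ} (M : Matrix (Fin d) (Fin d) ℂ) : ℝ :=
  ‖Matrix.toEuclideanCLM (n := Fin d) (𝕜 := ℂ) M‖

/-- The eigenvalues of a Hermitian matrix, with multiplicity, sorted from largest to smallest. -/
def spec {d : ℕ} {A : Matrix (Fin d) (Fin d) ℂ} (hA : A.IsHermitian) : Fin d → ℝ :=
  fun i => hA.eigenvalues₀ (Fin.cast (Fintype.card_fin d).symm i)

/-- The first `r` entries of a vector (all the entries if `d ≤ r`). -/
def firstEntries {d : ℕ} (r : ℕ) (x : Fin d → ℝ) : {i : Fin d // (i : ℕ) < r} → ℝ :=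
  fun i => x i

/-- Unit vectors of `ℂ^d`, representing pure states. -/
abbrev PureState (d : ℕ) : Type :=
  Metric.sphere (0 : EuclideanSpace ℂ (Fin d)) 1

/-- The rank-one projector `|u⟩⟨u|`. -/
def ketbra {d : ℕ} (u : PureState d) : Matrix (Fin d) (Fin d) ℂ :=
  Matrix.vecMulVec (fun i => u.1 i) (fun i => star (u.1 i))

/-- The law of a Haar random vector in `ℂ^d`: the uniform (unitarily invariant) probability
measure on the unit sphere, that is the surface measure divided by its total mass. -/
def haarPure (d : ℕ) : Measure (PureState d) :=
  ((volume : Measure (EuclideanSpace ℂ (Fin d))).toSphere Set.univ)⁻¹ •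
    (volume : Measure (EuclideanSpace ℂ (Fin d))).toSphere

/-- The law of the outcome when `ρ` is measured with the uniform POVM `{d · |u⟩⟨u| · du}`:
it has density `d · tr(|u⟩⟨u| ρ)` with respect to the Haar measure `du` over pure states. -/
def uniformPOVM {d : ℕ} (ρ : Matrix (Fin d) (Fin d) ℂ) : Measure (PureState d) :=
  (haarPure d).withDensity fun u => ENNReal.ofReal ((d : ℝ) * (ketbra u * ρ).trace.re)

/-- The joint law of the outcomes when each of `n` copies of `ρ` is measured with the
uniform POVM. -/
def uniformPOVMCopies {d : ℕ} (ρ : Matrix (Fin d) (Fin d) ℂ) (n : ℕ) :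
    Measure (Fin n → PureState d) :=
  Measure.pi fun _ => uniformPOVM ρ

/-- The output of uniform POVM tomography on the outcomes `u₁, …, uₙ`: the average of the
matrices `(d + 1) |uᵢ⟩⟨uᵢ| - I`. -/
def estimate {d n : ℕ} (u : Fin n → PureState d) : Matrix (Fin d) (Fin d) ℂ :=
  ((1 / n : ℝ) : ℂ) • ∑ i, (((d : ℂ) + 1) • ketbra (u i) - 1)

/-- The projector onto the span of the eigenvectors of the Hermitian matrix `A` with
eigenvalue at least `B`. -/
def thresholdProj {d : ℕ} {A : Matrix (Fin d) (Fin d) ℂ} (hA : A.IsHermitian) (B : ℝ) :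
    Matrix (Fin d) (Fin d) ℂ :=
  ∑ j : Fin d, if B ≤ hA.eigenvalues j then
    Matrix.vecMulVec (fun i => hA.eigenvectorBasis j i)
      (fun i => star (hA.eigenvectorBasis j i))
  else 0

theorem isHermitian_vecMulVec {d : ℕ} (v : Fin d → ℂ) :
    (Matrix.vecMulVec v (fun i => star (v i))).IsHermitian := by
  ext i j
  simp [Matrix.vecMulVec_apply, mul_comm]

theorem isHermitian_estimate {d n : ℕ} (u : Fin n → PureState d) :
    (estimate u).IsHermitian := by
  have h : ∀ i, (ketbra (u i)).conjTranspose = ketbra (u i) :=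
    fun i => isHermitian_vecMulVec _
  simp [Matrix.IsHermitian, estimate, Matrix.conjTranspose_smul, Matrix.conjTranspose_sum, h]

theorem isHermitian_thresholdProj {d : ℕ} {A : Matrix (Fin d) (Fin d) ℂ} (hA : A.IsHermitian)
    (B : ℝ) : (thresholdProj hA B).IsHermitian := by
  unfold Matrix.IsHermitian thresholdProj
  rw [Matrix.conjTranspose_sum]
  refine Finset.sum_congr rfl fun j _ => ?_
  split_ifs
  · exact isHermitian_vecMulVec _
  · simp

/-- The projector `Π` output by the uniform POVM bucketing algorithm with threshold `B` on the
measurement outcomes `u`. -/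
def bucket {d n : ℕ} (B : ℝ) (u : Fin n → PureState d) : Matrix (Fin d) (Fin d) ℂ :=
  thresholdProj (isHermitian_estimate u) B

/-- The pinched matrix `P ρ P + (1 - P) ρ (1 - P)`. -/
def pinch {d : ℕ} (P ρ : Matrix (Fin d) (Fin d) ℂ) : Matrix (Fin d) (Fin d) ℂ :=
  P * ρ * P + (1 - P) * ρ * (1 - P)

theorem isHermitian_pinch {d : ℕ} {P ρ : Matrix (Fin d) (Fin d) ℂ}
    (hP : P.IsHermitian) (hρ : ρ.IsHermitian) : (pinch P ρ).IsHermitian := by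
  have hP' : P.conjTranspose = P := hP
  have hρ' : ρ.conjTranspose = ρ := hρ
  simp [Matrix.IsHermitian, pinch, Matrix.conjTranspose_mul, hP', hρ', mul_assoc]

theorem isHermitian_bucket {d n : ℕ} (B : ℝ) (u : Fin n → PureState d) :
    (bucket B u).IsHermitian :=
  isHermitian_thresholdProj _ B

end

end UniformPOVM

/-! All conclusions follow deterministically from one event: ρ̂ is within δ = Bε/4 of ρ in operator
norm.

Probability. For a fixed unit vector v, X = (d+1)|⟨v,u⟩|² has mean 1 + ⟨v,ρv⟩ and k-th moment at
most (k+1)!, independently of d (`integral_uniformPOVM_inner_pow_le`). The Haar moments behind this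
come from Gaussian integrals in polar coordinates. Hence X has dimension-free exponential moments
near 0, and Chernoff bounds ⟨v,(ρ̂-ρ)v⟩ with failure probability exponentially small in nτ². A union
bound over a 1/4-net of at most 81^d unit vectors gives the operator norm bound once nτ² ≥ 200d
(`exists_opNorm_estimate_sub_le`).

Perturbation. By Weyl's inequality every sorted eigenvalue moves by at most δ. So the r top
eigenvalues of ρ are at least B - δ while summing to at most 1, which bounds r, and the first r
eigenvalues carry total error at most rδ. On the range of Π̄, ρ̂ is at most B, so ρ is at most B +
δ.

Pinching (`dTV_spec_pinch_le`). Using Weyl eigenvalue by eigenvalue would cost a factor d. Instead,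
Π commutes with ρ̂, so the removed off-diagonal blocks are those of ρ - ρ̂. Adding to ρ a positive
matrix of trace at most 2rδ dominates both ρ and its pinching, and monotonicity of eigenvalues turns
this trace into an ℓ¹ bound on the spectra. -/

namespace UniformPOVM

/-! ### Haar moments of a linear functional, from Gaussian integrals. -/

/-- Polar coordinates for a function that is a product of an angular and a radial part. -/
theorem integral_eq_integral_toSphere_mul {E : Type*} [NormedAddCommGroup E] [NormedSpace ℝ E]
    [MeasurableSpace E] [BorelSpace E] [Nontrivial E] [FiniteDimensional ℝ E]
    (μ : Measure E) [μ.IsAddHaarMeasure] (F : E → ℝ) (f : Metric.sphere (0 : E) 1 → ℝ) (g : ℝ → ℝ)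
    (hF : ∀ (u : Metric.sphere (0 : E) 1) (r : ℝ), 0 < r → F (r • u.1) = f u * g r) :
    ∫ x, F x ∂μ = (∫ u, f u ∂μ.toSphere) *
      ∫ y in Set.Ioi (0 : ℝ), y ^ (Module.finrank ℝ E - 1) * g y := by
  calc
    ∫ x, F x ∂μ = ∫ x : ({(0)}ᶜ : Set E), F x.1 ∂(μ.comap (↑)) := by
      rw [integral_subtype_comap (measurableSet_singleton _).compl F,
        restrict_compl_singleton]
    _ = ∫ x, f x.1 * g x.2 ∂μ.toSphere.prod (.volumeIoiPow (Module.finrank ℝ E - 1)) := by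
      rw [← μ.measurePreserving_homeomorphUnitSphereProd.integral_comp
        (Homeomorph.measurableEmbedding _)]
      refine integral_congr_ae (.of_forall fun x => ?_)
      have hx : 0 < ‖x.1‖ := norm_pos_iff.2 x.2
      have := hF (homeomorphUnitSphereProd E x).1 ‖x.1‖ hx
      simp only [homeomorphUnitSphereProd_apply_fst_coe] at this
      rw [smul_inv_smul₀ hx.ne'] at this
      simpa using this
    _ = (∫ u, f u ∂μ.toSphere) * ∫ x : Set.Ioi (0 : ℝ), g x ∂.volumeIoiPow (Module.finrank ℝ E - 1) :=
      integral_prod_mul f (fun x : Set.Ioi (0 : ℝ) => g x)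
    _ = _ := by
      congr 1
      simp only [Measure.volumeIoiPow, ENNReal.ofReal]
      rw [integral_withDensity_eq_integral_smul,
        integral_subtype_comap measurableSet_Ioi
          fun a ↦ Real.toNNReal (a ^ (Module.finrank ℝ E - 1)) • g a,
        setIntegral_congr_fun measurableSet_Ioi fun x hx ↦ ?_]
      · rw [NNReal.smul_def, Real.coe_toNNReal _ (pow_nonneg (le_of_lt hx) _), smul_eq_mul]
      · exact (measurable_subtype_coe.pow_const _).real_toNNReal

theorem integral_norm_pow_mul_exp_neg_sq (k : ℕ) :
    ∫ z : ℂ, ‖z‖ ^ (2 * k) * Real.exp (-‖z‖ ^ 2) = Real.pi * k.factorial := by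
  have h := Complex.integral_rpow_mul_exp_neg_rpow (p := 2) (q := ((2 * k : ℕ) : ℝ)) (by norm_num)
    (by linarith [Nat.cast_nonneg (α := ℝ) (2 * k)])
  simp only [Real.rpow_natCast, Real.rpow_ofNat] at h
  rw [h, show (((2 * k : ℕ) : ℝ) + 2) / 2 = k + 1 by push_cast; ring, Real.Gamma_nat_eq_factorial]
  ring

/-- Odd powers suffice: ℂ^d has real dimension 2d, so the radial weight is y^(2d-1). -/
theorem integral_Ioi_pow_mul_exp_neg_sq (m : ℕ) :
    ∫ y in Set.Ioi (0 : ℝ), y ^ (2 * m + 1) * Real.exp (-y ^ 2) = m.factorial / 2 := by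
  have h := integral_rpow_mul_exp_neg_rpow (p := 2) (q := ((2 * m + 1 : ℕ) : ℝ)) (by norm_num)
    (by linarith [Nat.cast_nonneg (α := ℝ) (2 * m + 1)])
  simp only [Real.rpow_natCast, Real.rpow_ofNat] at h
  rw [h, show (((2 * m + 1 : ℕ) : ℝ) + 1) / 2 = m + 1 by push_cast; ring,
    Real.Gamma_nat_eq_factorial]
  ring

/-- Gaussian moments of a linear functional, up to a constant that depends only on the chosen
orthonormal basis. -/
theorem exists_integral_inner_pow_mul_exp {d : ℕ} (v : EuclideanSpace ℂ (Fin d)) (hv : ‖v‖ = 1) :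
    ∃ c : ℝ, 0 < c ∧ ∀ k : ℕ, ∫ x : EuclideanSpace ℂ (Fin d),
      ‖inner ℂ v x‖ ^ (2 * k) * Real.exp (-‖x‖ ^ 2) = c * k.factorial := by
  have hd : d ≠ 0 := by
    rintro rfl
    rw [Subsingleton.elim v 0, norm_zero] at hv
    exact zero_ne_one hv
  let i₀ : Fin d := ⟨0, Nat.pos_of_ne_zero hd⟩
  obtain ⟨b, hb⟩ := Orthonormal.exists_orthonormalBasis_extension_of_card_eq (𝕜 := ℂ)
    (E := EuclideanSpace ℂ (Fin d)) (ι := Fin d) (by simp) (v := fun _ => v) (s := {i₀}) (by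
      rw [orthonormal_iff_ite]
      rintro ⟨i, rfl⟩ ⟨j, rfl⟩
      simp [hv])
  have hbv : b i₀ = v := hb i₀ rfl
  let L : (Fin d → ℂ) ≃L[ℝ] EuclideanSpace ℂ (Fin d) :=
    (((WithLp.linearEquiv 2 ℂ (Fin d → ℂ)).symm.trans
      b.repr.symm.toLinearEquiv).restrictScalars ℝ).toContinuousLinearEquiv
  have hL : ∀ x, b.repr (L x) = WithLp.toLp 2 x := fun x => by simp [L]
  have hLn : ∀ x, ‖L x‖ ^ 2 = ∑ i, ‖x i‖ ^ 2 := fun x => by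
    rw [← b.repr.norm_map, hL, EuclideanSpace.norm_sq_eq]
  have hLi : ∀ x, inner ℂ v (L x) = x i₀ := fun x => by
    rw [← hbv, ← b.repr_apply_apply, hL]
  let μ : Measure (EuclideanSpace ℂ (Fin d)) := (volume : Measure (Fin d → ℂ)).map L
  -- The factor `a` between the two Haar measures is never evaluated: it does not depend on `k` and
  -- cancels against the case `k = 0`.
  have : μ.IsAddHaarMeasure := L.isAddHaarMeasure_map volume
  set a := Measure.addHaarScalarFactor (volume : Measure (EuclideanSpace ℂ (Fin d))) μ
  have hvol : (volume : Measure (EuclideanSpace ℂ (Fin d))) = a • μ :=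
    Measure.isAddLeftInvariant_eq_smul _ _
  have ha0 : 0 < a := Measure.addHaarScalarFactor_pos_of_isAddHaarMeasure _ _
  refine ⟨a * Real.pi ^ d, by positivity, fun k => ?_⟩
  rw [hvol, integral_smul_nnreal_measure]
  have hmap : ∫ x, ‖inner ℂ v x‖ ^ (2 * k) * Real.exp (-‖x‖ ^ 2) ∂μ
      = ∫ x : Fin d → ℂ, ∏ i, (‖x i‖ ^ (2 * (if i = i₀ then k else 0)) * Real.exp (-‖x i‖ ^ 2)) := by
    rw [show μ = (volume : Measure (Fin d → ℂ)).map L.toHomeomorph from rfl,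
      L.toHomeomorph.measurableEmbedding.integral_map]
    refine integral_congr_ae (.of_forall fun x => ?_)
    change ‖inner ℂ v (L x)‖ ^ (2 * k) * Real.exp (-‖L x‖ ^ 2) = _
    dsimp only
    rw [hLi, hLn, Finset.prod_mul_distrib, ← Real.exp_sum, Finset.sum_neg_distrib]
    congr 1
    rw [Finset.prod_eq_single i₀] <;> simp +contextual
  rw [hmap, integral_fintype_prod_volume_eq_prod
    (fun (i : Fin d) (z : ℂ) => ‖z‖ ^ (2 * (if i = i₀ then k else 0)) * Real.exp (-‖z‖ ^ 2))]
  simp_rw [integral_norm_pow_mul_exp_neg_sq]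
  rw [Finset.prod_mul_distrib, Finset.prod_eq_single (f := fun i => ((if i = i₀ then k else 0).factorial : ℝ)) i₀]
    <;> simp +contextual [NNReal.smul_def, mul_assoc]

/-- Moments of `|⟨v, u⟩|²` for a Haar random unit vector `u`. -/
theorem integral_toSphere_inner_pow {d : ℕ} (v : EuclideanSpace ℂ (Fin d)) (hv : ‖v‖ = 1) (k : ℕ) :
    ∫ u : PureState d, ‖inner ℂ v u.1‖ ^ (2 * k)
        ∂(volume : Measure (EuclideanSpace ℂ (Fin d))).toSphere =
      (volume : Measure (EuclideanSpace ℂ (Fin d))).toSphere.real Set.univ *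
        (k.factorial * (d - 1).factorial / (d + k - 1).factorial) := by
  have hd : 0 < d := by
    rcases Nat.eq_zero_or_pos d with rfl | h
    · rw [Subsingleton.elim v 0, norm_zero] at hv
      exact absurd hv zero_ne_one
    · exact h
  have : Nontrivial (EuclideanSpace ℂ (Fin d)) := ⟨v, 0, fun h => by simp [h] at hv⟩
  obtain ⟨c, hc, H⟩ := exists_integral_inner_pow_mul_exp v hv
  have hfin : Module.finrank ℝ (EuclideanSpace ℂ (Fin d)) = 2 * d := by
    rw [finrank_real_of_complex]; simp
  have key : ∀ k : ℕ, c * k.factorial =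
      (∫ u : PureState d, ‖inner ℂ v u.1‖ ^ (2 * k)
        ∂(volume : Measure (EuclideanSpace ℂ (Fin d))).toSphere) *
        ((d + k - 1).factorial / 2) := fun k => by
    rw [← H k, integral_eq_integral_toSphere_mul volume _
      (fun u : PureState d => ‖inner ℂ v u.1‖ ^ (2 * k))
      (fun r => r ^ (2 * k) * Real.exp (-r ^ 2))]
    · rw [hfin, ← integral_Ioi_pow_mul_exp_neg_sq]
      congr 2
      ext y
      rw [← mul_assoc, ← pow_add]
      congr 2
      omega
    · intro u r hr
      have hu : ‖u.1‖ = 1 := norm_eq_of_mem_sphere u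
      rw [inner_smul_right_eq_smul, norm_smul, norm_smul, hu, Real.norm_of_nonneg hr.le]
      ring_nf
  -- The case `k = 0` expresses `c` through the total mass of the sphere.
  have h0 := key 0
  have hk := key k
  simp only [mul_zero, pow_zero, integral_const, smul_eq_mul, mul_one, Nat.factorial_zero,
    Nat.cast_one, add_zero] at h0
  have hf : ((d + k - 1).factorial : ℝ) ≠ 0 := by positivity
  field_simp at hk ⊢
  rw [h0] at hk
  linarith

/-! ### Quadratic forms, mixed Haar moments, and moments of one measurement outcome. -/

section

variable {d : ℕ}

/-- The real part of the quadratic form `⟨x, M x⟩` of a matrix. -/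
noncomputable def quadForm (M : Matrix (Fin d) (Fin d) ℂ) (x : EuclideanSpace ℂ (Fin d)) : ℝ :=
  (inner ℂ x (Matrix.toEuclideanCLM (n := Fin d) (𝕜 := ℂ) M x)).re

theorem toEuclideanCLM_eigenvectorBasis {A : Matrix (Fin d) (Fin d) ℂ} (hA : A.IsHermitian)
    (j : Fin d) : Matrix.toEuclideanCLM (n := Fin d) (𝕜 := ℂ) A (hA.eigenvectorBasis j) =
      (hA.eigenvalues j : ℂ) • hA.eigenvectorBasis j := by
  apply (WithLp.equiv 2 _).injective
  simpa using hA.mulVec_eigenvectorBasis j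

theorem isSymmetric_toEuclideanCLM {A : Matrix (Fin d) (Fin d) ℂ} (hA : A.IsHermitian)
    (x y : EuclideanSpace ℂ (Fin d)) :
    inner ℂ (Matrix.toEuclideanCLM (n := Fin d) (𝕜 := ℂ) A x) y =
      inner ℂ x (Matrix.toEuclideanCLM (n := Fin d) (𝕜 := ℂ) A y) :=
  Matrix.isSymmetric_toEuclideanLin_iff.mpr hA x y

/-- The quadratic form in the eigenbasis. -/
theorem quadForm_eq_sum {A : Matrix (Fin d) (Fin d) ℂ} (hA : A.IsHermitian)
    (x : EuclideanSpace ℂ (Fin d)) :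
    quadForm A x = ∑ j, hA.eigenvalues j * ‖inner ℂ (hA.eigenvectorBasis j) x‖ ^ 2 := by
  rw [quadForm, ← hA.eigenvectorBasis.sum_inner_mul_inner, Complex.re_sum]
  refine Finset.sum_congr rfl fun j _ => ?_
  rw [← isSymmetric_toEuclideanCLM hA, toEuclideanCLM_eigenvectorBasis, inner_smul_left,
    Complex.conj_ofReal, mul_left_comm, ← inner_conj_symm, Complex.re_ofReal_mul,
    ← Complex.normSq_eq_conj_mul_self, Complex.ofReal_re, Complex.normSq_eq_norm_sq]

theorem trace_ketbra_mul (u : PureState d) (M : Matrix (Fin d) (Fin d) ℂ) :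
    (ketbra u * M).trace = inner ℂ u.1 (Matrix.toEuclideanCLM (n := Fin d) (𝕜 := ℂ) M u.1) := by
  rw [ketbra, Matrix.vecMulVec_mul, Matrix.trace_vecMulVec, EuclideanSpace.inner_eq_star_dotProduct,
    Matrix.ofLp_toEuclideanCLM, dotProduct_comm, ← Matrix.dotProduct_mulVec, dotProduct_comm]
  rfl

theorem quadForm_ketbra (u : PureState d) (v : EuclideanSpace ℂ (Fin d)) :
    quadForm (ketbra u) v = ‖inner ℂ v u.1‖ ^ 2 := by
  have h : Matrix.toEuclideanCLM (n := Fin d) (𝕜 := ℂ) (ketbra u) v =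
      (inner ℂ u.1 v : ℂ) • u.1 := by
    ext i
    simp [Matrix.ofLp_toEuclideanCLM, ketbra, Matrix.vecMulVec_mulVec,
      EuclideanSpace.inner_eq_star_dotProduct, dotProduct_comm, mul_comm]
    left
    rfl
  rw [quadForm, h, inner_smul_right, ← inner_conj_symm, ← Complex.normSq_eq_conj_mul_self,
    Complex.ofReal_re, Complex.normSq_eq_norm_sq]

theorem integrable_of_continuous {X : Type*} [TopologicalSpace X] [CompactSpace X]
    [MeasurableSpace X] [OpensMeasurableSpace X] (μ : Measure X) [IsFiniteMeasure μ] {f : X → ℝ}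
    (hf : Continuous f) : Integrable f μ :=
  hf.integrable_of_hasCompactSupport (.of_compactSpace f)

instance [NeZero d] : Nontrivial (EuclideanSpace ℂ (Fin d)) :=
  ⟨EuclideanSpace.single 0 1, 0, fun h => by simpa using congrArg norm h⟩

instance [NeZero d] : IsProbabilityMeasure (haarPure d) where
  measure_univ := by
    rw [haarPure, Measure.smul_apply, smul_eq_mul]
    exact ENNReal.inv_mul_cancel
      (Measure.measure_univ_ne_zero.2 (Measure.toSphere_ne_zero _)) (measure_ne_top _ _)

theorem integral_haarPure_inner_pow [NeZero d] {v : EuclideanSpace ℂ (Fin d)} (hv : ‖v‖ = 1)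
    (k : ℕ) : ∫ u, ‖inner ℂ v u.1‖ ^ (2 * k) ∂haarPure d =
      k.factorial * (d - 1).factorial / (d + k - 1).factorial := by
  have h0 : (volume : Measure (EuclideanSpace ℂ (Fin d))).toSphere.real Set.univ ≠ 0 := by
    rw [Ne, measureReal_eq_zero_iff]
    exact Measure.measure_univ_ne_zero.2 (Measure.toSphere_ne_zero _)
  rw [haarPure, integral_smul_measure, integral_toSphere_inner_pow v hv, ENNReal.toReal_inv,
    smul_eq_mul, ← Measure.real, inv_mul_cancel_left₀ h0]

theorem integral_haarPure_inner_sq [NeZero d] {v : EuclideanSpace ℂ (Fin d)} (hv : ‖v‖ = 1) :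
    ∫ u, ‖inner ℂ v u.1‖ ^ 2 ∂haarPure d = 1 / d := by
  obtain ⟨m, rfl⟩ := Nat.exists_eq_succ_of_ne_zero (NeZero.ne d)
  have h := integral_haarPure_inner_pow hv 1
  rw [mul_one] at h
  rw [h]
  simp [Nat.factorial_succ]
  field_simp

theorem integral_haarPure_inner_pow_four [NeZero d] (v : EuclideanSpace ℂ (Fin d)) :
    ∫ u, ‖inner ℂ v u.1‖ ^ 4 ∂haarPure d = 2 / (d * (d + 1)) * ‖v‖ ^ 4 := by
  rcases eq_or_ne v 0 with rfl | hv
  · simp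
  have hv' : ‖v‖ ≠ 0 := norm_ne_zero_iff.2 hv
  have h1 : ‖((‖v‖⁻¹ : ℝ) : ℂ) • v‖ = 1 := by
    rw [norm_smul, Complex.norm_real, norm_inv, norm_norm, inv_mul_cancel₀ hv']
  have h := integral_haarPure_inner_pow h1 2
  simp only [inner_smul_left, norm_mul, RCLike.norm_conj, Complex.norm_real, norm_inv, norm_norm,
    mul_pow, integral_const_mul] at h
  obtain ⟨m, rfl⟩ := Nat.exists_eq_succ_of_ne_zero (NeZero.ne d)
  rw [show (2 * 2 : ℕ) = 4 from rfl, inv_pow, inv_mul_eq_iff_eq_mul₀ (pow_ne_zero _ hv')] at h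
  rw [h]
  simp [Nat.factorial_succ]
  field_simp

/-- Degree-four polarization: averaging over the fourth roots of unity kills every mixed term except
|a|²|b|². This reduces mixed moments to fourth moments of single functionals. -/
theorem sum_norm_add_I_pow_mul_pow_four (a b : ℂ) :
    ‖a + b‖ ^ 4 + ‖a - b‖ ^ 4 + ‖a + Complex.I * b‖ ^ 4 + ‖a - Complex.I * b‖ ^ 4 =
      4 * ‖a‖ ^ 4 + 4 * ‖b‖ ^ 4 + 16 * (‖a‖ ^ 2 * ‖b‖ ^ 2) := by
  have h : ∀ z : ℂ, ‖z‖ ^ 4 = (z.re * z.re + z.im * z.im) ^ 2 := fun z => by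
    rw [← Complex.normSq_apply, Complex.normSq_eq_norm_sq]; ring
  have h2 : ∀ z : ℂ, ‖z‖ ^ 2 = z.re * z.re + z.im * z.im := fun z => by
    rw [← Complex.normSq_apply, Complex.normSq_eq_norm_sq]
  simp only [h, h2, Complex.add_re, Complex.add_im, Complex.sub_re, Complex.sub_im, Complex.mul_re,
    Complex.mul_im, Complex.I_re, Complex.I_im]
  ring

/-- Evaluates the polarized fourth moments, which are proportional to ‖w‖⁴. The pair ±v contributes
the real part of the inner product and the pair ±iv the imaginary part. -/
theorem sum_norm_add_I_smul_pow_four {e v : EuclideanSpace ℂ (Fin d)} (he : ‖e‖ = 1) (hv : ‖v‖ = 1) :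
    ‖e + v‖ ^ 4 + ‖e - v‖ ^ 4 + ‖e + Complex.I • v‖ ^ 4 + ‖e - Complex.I • v‖ ^ 4 =
      16 + 8 * ‖inner ℂ e v‖ ^ 2 := by
  have h2 : ‖inner ℂ e v‖ ^ 2 = (inner ℂ e v).re ^ 2 + (inner ℂ e v).im ^ 2 := by
    rw [← Complex.normSq_eq_norm_sq, Complex.normSq_apply]; ring
  have hI : ‖Complex.I • v‖ = 1 := by simp [norm_smul, hv]
  have hre : (inner ℂ e (Complex.I • v)).re = -(inner ℂ e v).im := by
    simp
  have key : ∀ w : EuclideanSpace ℂ (Fin d), ‖w‖ = 1 →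
      ‖e + w‖ ^ 4 + ‖e - w‖ ^ 4 = 8 + 8 * (inner ℂ e w).re ^ 2 := fun w hw => by
    have h3 := norm_add_sq (𝕜 := ℂ) e w
    have h4 := norm_sub_sq (𝕜 := ℂ) e w
    rw [he, hw] at h3 h4
    simp only [RCLike.re_to_complex] at h3 h4
    rw [show ‖e + w‖ ^ 4 = (‖e + w‖ ^ 2) ^ 2 by ring, show ‖e - w‖ ^ 4 = (‖e - w‖ ^ 2) ^ 2 by ring,
      h3, h4]
    ring
  have k1 := key v hv
  have k2 := key _ hI
  rw [hre] at k2
  rw [h2]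
  linarith

/-- The Haar measure on pure states is a `2`-design. -/
theorem integral_haarPure_inner_sq_mul_inner_sq [NeZero d] {e v : EuclideanSpace ℂ (Fin d)}
    (he : ‖e‖ = 1) (hv : ‖v‖ = 1) :
    ∫ u, ‖inner ℂ e u.1‖ ^ 2 * ‖inner ℂ v u.1‖ ^ 2 ∂haarPure d =
      (1 + ‖inner ℂ e v‖ ^ 2) / (d * (d + 1)) := by
  have hint : ∀ w : EuclideanSpace ℂ (Fin d),
      Integrable (fun u : PureState d => ‖inner ℂ w u.1‖ ^ 4) (haarPure d) :=
    fun w => integrable_of_continuous _ (by fun_prop)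
  have hpt : ∀ u : PureState d, ‖inner ℂ e u.1‖ ^ 2 * ‖inner ℂ v u.1‖ ^ 2 =
      (1 / 16) * (‖inner ℂ (e + v) u.1‖ ^ 4 + ‖inner ℂ (e - v) u.1‖ ^ 4 +
        ‖inner ℂ (e + Complex.I • v) u.1‖ ^ 4 + ‖inner ℂ (e - Complex.I • v) u.1‖ ^ 4
        - 4 * ‖inner ℂ e u.1‖ ^ 4 - 4 * ‖inner ℂ v u.1‖ ^ 4) := fun u => by
    have := sum_norm_add_I_pow_mul_pow_four (inner ℂ e u.1) (inner ℂ v u.1)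
    simp only [inner_add_left, inner_sub_left, inner_smul_left, Complex.conj_I, neg_mul,
      sub_neg_eq_add, ← sub_eq_add_neg]
    linarith
  simp_rw [hpt]
  rw [integral_const_mul, integral_sub, integral_sub, integral_add, integral_add, integral_add,
    integral_const_mul, integral_const_mul]
  · simp_rw [integral_haarPure_inner_pow_four]
    have := sum_norm_add_I_smul_pow_four he hv
    have hd : (d : ℝ) ≠ 0 := by exact_mod_cast NeZero.ne d
    rw [he, hv]
    field_simp
    linarith
  all_goals
    first
    | exact hint _
    | exact integrable_of_continuous _ (by fun_prop)

/-- Weighted AM-GM. The induction step multiplies by b and adds (a^(k+1) - b^(k+1))(a - b) ≥ 0. -/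
theorem succ_mul_mul_pow_le {a b : ℝ} (ha : 0 ≤ a) (hb : 0 ≤ b) (k : ℕ) :
    (k + 1) * (a * b ^ k) ≤ a ^ (k + 1) + k * b ^ (k + 1) := by
  induction k with
  | zero => simp
  | succ k ih =>
    have h : 0 ≤ (a ^ (k + 1) - b ^ (k + 1)) * (a - b) := by
      rcases le_total a b with h | h
      · exact mul_nonneg_of_nonpos_of_nonpos (sub_nonpos.2 (pow_le_pow_left₀ ha h _))
          (sub_nonpos.2 h)
      · exact mul_nonneg (sub_nonneg.2 (pow_le_pow_left₀ hb h _)) (sub_nonneg.2 h)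
    have h2 := mul_le_mul_of_nonneg_left ih hb
    push_cast
    ring_nf at h h2 ⊢
    linarith

/-- AM-GM replaces the mixed moment by a convex combination of two pure moments of order k+1, which
coincide by unitary invariance. The bound is attained at e = v. -/
theorem integral_haarPure_inner_sq_mul_inner_pow_le [NeZero d] {e v : EuclideanSpace ℂ (Fin d)}
    (he : ‖e‖ = 1) (hv : ‖v‖ = 1) (k : ℕ) :
    ∫ u, ‖inner ℂ e u.1‖ ^ 2 * ‖inner ℂ v u.1‖ ^ (2 * k) ∂haarPure d ≤
      (k + 1).factorial * (d - 1).factorial / (d + k).factorial := by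
  have hpt : ∀ a b : ℝ, a ^ 2 * b ^ (2 * k) ≤
      1 / (k + 1) * (a ^ (2 * (k + 1)) + k * b ^ (2 * (k + 1))) := fun a b => by
    have := succ_mul_mul_pow_le (sq_nonneg a) (sq_nonneg b) k
    rw [one_div, ← div_eq_inv_mul, le_div_iff₀ (by positivity), mul_comm]
    simpa only [pow_mul] using this
  have hint : ∀ w : EuclideanSpace ℂ (Fin d),
      Integrable (fun u : PureState d => ‖inner ℂ w u.1‖ ^ (2 * (k + 1))) (haarPure d) :=
    fun w => integrable_of_continuous _ (by fun_prop)
  calc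
    _ ≤ ∫ u, 1 / ((k : ℝ) + 1) * (‖inner ℂ e u.1‖ ^ (2 * (k + 1)) +
          k * ‖inner ℂ v u.1‖ ^ (2 * (k + 1))) ∂haarPure d :=
      integral_mono (integrable_of_continuous _ (by fun_prop))
        (integrable_of_continuous _ (by fun_prop)) fun u => hpt _ _
    _ = _ := by
      rw [integral_const_mul, integral_add (hint e) ((hint v).const_mul _), integral_const_mul,
        integral_haarPure_inner_pow he, integral_haarPure_inner_pow hv, ← add_assoc,
        Nat.add_sub_cancel]
      have : (k : ℝ) + 1 ≠ 0 := by positivity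
      field_simp
      ring

section Outcome

variable {ρ : Matrix (Fin d) (Fin d) ℂ}

/-- The empty matrix has trace 0, so the degenerate dimension is excluded. -/
theorem IsDensityMatrix.neZero (hρ : IsDensityMatrix ρ) : NeZero d := ⟨by
  rintro rfl
  simpa [Matrix.trace] using hρ.trace_eq_one⟩

theorem IsDensityMatrix.sum_eigenvalues (hρ : IsDensityMatrix ρ) :
    ∑ j, hρ.posSemidef.isHermitian.eigenvalues j = 1 := by
  have h := hρ.posSemidef.isHermitian.trace_eq_sum_eigenvalues
  rw [hρ.trace_eq_one] at h
  have h2 := congrArg Complex.re h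
  simpa using h2.symm

theorem trace_ketbra_mul_re (hρ : IsDensityMatrix ρ) (u : PureState d) :
    (ketbra u * ρ).trace.re = ∑ j, hρ.posSemidef.isHermitian.eigenvalues j *
      ‖inner ℂ (hρ.posSemidef.isHermitian.eigenvectorBasis j) u.1‖ ^ 2 := by
  rw [trace_ketbra_mul, ← quadForm_eq_sum]
  rfl

/-- Expectations under the outcome distribution of the uniform POVM, in the eigenbasis of `ρ`. -/
theorem integral_uniformPOVM (hρ : IsDensityMatrix ρ) {g : PureState d → ℝ} (hg : Continuous g) :
    ∫ u, g u ∂uniformPOVM ρ = ∑ j, hρ.posSemidef.isHermitian.eigenvalues j *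
      (d * ∫ u, ‖inner ℂ (hρ.posSemidef.isHermitian.eigenvectorBasis j) u.1‖ ^ 2 * g u
        ∂haarPure d) := by
  have := hρ.neZero
  simp_rw [uniformPOVM, trace_ketbra_mul_re hρ]
  have hnn : ∀ u : PureState d, 0 ≤ (d : ℝ) * ∑ j, hρ.posSemidef.isHermitian.eigenvalues j *
      ‖inner ℂ (hρ.posSemidef.isHermitian.eigenvectorBasis j) u.1‖ ^ 2 := fun u =>
    mul_nonneg (Nat.cast_nonneg _) (Finset.sum_nonneg fun j _ =>
      mul_nonneg (hρ.posSemidef.eigenvalues_nonneg j) (sq_nonneg _))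
  rw [integral_withDensity_eq_integral_toReal_smul
    (by fun_prop) (.of_forall fun u => ENNReal.ofReal_lt_top)]
  simp_rw [ENNReal.toReal_ofReal (hnn _), smul_eq_mul, Finset.mul_sum, Finset.sum_mul]
  rw [integral_finsetSum _ fun j _ => integrable_of_continuous _ (by fun_prop)]
  refine Finset.sum_congr rfl fun j _ => ?_
  rw [← integral_const_mul, ← integral_const_mul]
  congr 1
  ext u
  ring

theorem isProbabilityMeasure_uniformPOVM (hρ : IsDensityMatrix ρ) :
    IsProbabilityMeasure (uniformPOVM ρ) where
  measure_univ := by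
    have := hρ.neZero
    have hd : (d : ℝ) ≠ 0 := by exact_mod_cast NeZero.ne d
    have h := integral_uniformPOVM hρ (g := fun _ => 1) continuous_const
    simp_rw [mul_one] at h
    simp only [integral_haarPure_inner_sq (hρ.posSemidef.isHermitian.eigenvectorBasis.norm_eq_one _),
      mul_one_div_cancel hd, mul_one, hρ.sum_eigenvalues, integral_const, smul_eq_mul] at h
    rwa [Measure.real, ENNReal.toReal_eq_one_iff] at h

/-- The estimator of a single outcome is unbiased. -/
theorem integral_uniformPOVM_inner_sq (hρ : IsDensityMatrix ρ) {v : EuclideanSpace ℂ (Fin d)}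
    (hv : ‖v‖ = 1) :
    ∫ u, (d + 1) * ‖inner ℂ v u.1‖ ^ 2 ∂uniformPOVM ρ = 1 + quadForm ρ v := by
  have := hρ.neZero
  have hd : (d : ℝ) ≠ 0 := by exact_mod_cast NeZero.ne d
  rw [integral_const_mul, integral_uniformPOVM hρ (by fun_prop)]
  simp_rw [integral_haarPure_inner_sq_mul_inner_sq
    (hρ.posSemidef.isHermitian.eigenvectorBasis.norm_eq_one _) hv]
  rw [quadForm_eq_sum hρ.posSemidef.isHermitian]
  conv_rhs => rw [← hρ.sum_eigenvalues]
  rw [Finset.mul_sum, ← Finset.sum_add_distrib]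
  refine Finset.sum_congr rfl fun j _ => ?_
  field_simp

/-- The dimension disappears because d!(d+1)^k ≤ (d+k)!; this is why the sample size is only linear
in d. -/
theorem integral_uniformPOVM_inner_pow_le (hρ : IsDensityMatrix ρ)
    {v : EuclideanSpace ℂ (Fin d)} (hv : ‖v‖ = 1) (k : ℕ) :
    ∫ u, ((d + 1) * ‖inner ℂ v u.1‖ ^ 2) ^ k ∂uniformPOVM ρ ≤
      ((k + 1).factorial : ℝ) := by
  have := hρ.neZero
  have hle : ∀ j, (d : ℝ) * ∫ u, ‖inner ℂ (hρ.posSemidef.isHermitian.eigenvectorBasis j) u.1‖ ^ 2 *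
      ((d + 1) * ‖inner ℂ v u.1‖ ^ 2) ^ k ∂haarPure d ≤ (k + 1).factorial := fun j => by
    simp_rw [mul_pow, ← pow_mul, mul_left_comm _ (((d : ℝ) + 1) ^ k)]
    rw [integral_const_mul]
    have h1 := integral_haarPure_inner_sq_mul_inner_pow_le
      (hρ.posSemidef.isHermitian.eigenvectorBasis.norm_eq_one j) hv k
    have h2 : (d.factorial : ℝ) * (d + 1) ^ k ≤ (d + k).factorial := by
      exact_mod_cast Nat.factorial_mul_pow_le_factorial
    have h3 : (d : ℝ) * (d - 1).factorial = d.factorial := by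
      exact_mod_cast Nat.mul_factorial_pred (NeZero.ne d)
    calc
      _ ≤ (d : ℝ) * ((d + 1) ^ k * ((k + 1).factorial * (d - 1).factorial / (d + k).factorial)) := by
        gcongr
      _ = (k + 1).factorial * (d.factorial * (d + 1) ^ k / (d + k).factorial) := by
        rw [← h3]; ring
      _ ≤ (k + 1).factorial * 1 := by
        gcongr
        exact div_le_one_of_le₀ h2 (by positivity)
      _ = _ := mul_one _
  rw [integral_uniformPOVM hρ (by fun_prop)]
  calc
    _ ≤ ∑ j, hρ.posSemidef.isHermitian.eigenvalues j * ((k + 1).factorial : ℝ) :=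
      Finset.sum_le_sum fun j _ =>
        mul_le_mul_of_nonneg_left (hle j) (hρ.posSemidef.eigenvalues_nonneg j)
    _ = _ := by rw [← Finset.sum_mul, hρ.sum_eigenvalues, one_mul]

end Outcome

end

/-! ### Exponential moments and Chernoff bounds. -/

section

variable {d : ℕ} {ρ : Matrix (Fin d) (Fin d) ℂ}

/-- Bounds the exponential series from degree 2 on, after s² is factored out, for |s| ≤ 1/4. The
value 40/9 < 5 produces the constant 5 in the exponent below. -/
theorem hasSum_add_three_mul_geometric :
    HasSum (fun k : ℕ => ((k : ℝ) + 3) * (1 / 4) ^ k) (40 / 9) := by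
  have h1 := hasSum_coe_mul_geometric_of_norm_lt_one (𝕜 := ℝ) (r := 1 / 4) (by norm_num)
  have h2 := (hasSum_geometric_of_lt_one (r := (1 / 4 : ℝ)) (by norm_num) (by norm_num)).mul_left 3
  convert! h1.add h2 using 1
  · ext k; ring
  · norm_num

/-- Exponential moments of a nonnegative random variable with moments `E X^k ≤ (k+1)!`. -/
theorem integral_exp_mul_le_of_moments {Ω : Type*} [MeasurableSpace Ω] {μ : Measure Ω}
    [IsProbabilityMeasure μ] {X : Ω → ℝ} (hX : ∀ ω, 0 ≤ X ω)
    (hint : ∀ k : ℕ, Integrable (fun ω => X ω ^ k) μ)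
    (hmom : ∀ k : ℕ, ∫ ω, X ω ^ k ∂μ ≤ ((k + 1).factorial : ℝ)) {s : ℝ} (hs : |s| ≤ 1 / 4) :
    ∫ ω, Real.exp (s * X ω) ∂μ ≤ Real.exp (s * ∫ ω, X ω ∂μ + 5 * s ^ 2) := by
  let F : ℕ → Ω → ℝ := fun k ω => (s * X ω) ^ k / k.factorial
  have hF : ∀ k, F k = fun ω => s ^ k / k.factorial * X ω ^ k := fun k => by
    ext ω; simp only [F]; ring
  have hFint : ∀ k, Integrable (F k) μ := fun k => by
    rw [hF]; exact (hint k).const_mul _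
  have hnn : ∀ k, 0 ≤ ∫ ω, X ω ^ k ∂μ := fun k => integral_nonneg fun ω => pow_nonneg (hX ω) k
  have hFnorm : ∀ k, ∫ ω, ‖F k ω‖ ∂μ = |s| ^ k / k.factorial * ∫ ω, X ω ^ k ∂μ := fun k => by
    rw [← integral_const_mul, hF]
    congr 1
    ext ω
    simp [abs_of_nonneg (hX ω)]
  have hFle : ∀ k, ∫ ω, ‖F k ω‖ ∂μ ≤ (k + 1) * |s| ^ k := fun k => by
    rw [hFnorm]
    calc
      _ ≤ |s| ^ k / k.factorial * ((k + 1).factorial : ℝ) := by gcongr; exact hmom k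
      _ = _ := by rw [Nat.factorial_succ]; push_cast; field_simp
  have hFle' : ∀ k, ∫ ω, F k ω ∂μ ≤ (k + 1) * |s| ^ k := fun k =>
    (integral_mono (hFint k) (hFint k).norm fun ω => Real.le_norm_self _).trans (hFle k)
  have hle : ∀ k : ℕ, ∫ ω, ‖F k ω‖ ∂μ ≤ ((k : ℝ) + 3) * (1 / 4) ^ k := fun k =>
    (hFle k).trans (by gcongr; norm_num)
  have hsum : HasSum (fun k => ∫ ω, F k ω ∂μ) (∫ ω, ∑' k, F k ω ∂μ) :=
    hasSum_integral_of_summable_integral_norm hFint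
      (Summable.of_nonneg_of_le (fun k => integral_nonneg fun ω => norm_nonneg _) hle
        hasSum_add_three_mul_geometric.summable)
  have hexp : ∀ ω, ∑' k, F k ω = Real.exp (s * X ω) := fun ω => by
    rw [Real.exp_eq_exp_ℝ, NormedSpace.exp_eq_tsum_div]
  simp_rw [hexp] at hsum
  -- The terms of degree 0 and 1 are kept exactly; the rest is at most 5s², and 1 + x ≤ exp x
  -- finishes.
  have hsum2 := (hasSum_nat_add_iff' 2).2 hsum
  have hbd : ∀ k : ℕ, ∫ ω, F (k + 2) ω ∂μ ≤ s ^ 2 * (((k : ℝ) + 3) * (1 / 4) ^ k) := fun k => by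
    refine (hFle' _).trans ?_
    have : |s| ^ k ≤ (1 / 4) ^ k := by gcongr
    calc
      _ = s ^ 2 * (((k : ℝ) + 3) * |s| ^ k) := by rw [pow_add, sq_abs]; push_cast; ring
      _ ≤ _ := by gcongr
  have h := hasSum_le hbd hsum2 (hasSum_add_three_mul_geometric.mul_left (s ^ 2))
  have h0 : ∫ ω, F 0 ω ∂μ = 1 := by simp [F]
  have h1 : ∫ ω, F 1 ω ∂μ = s * ∫ ω, X ω ∂μ := by simp [F, integral_const_mul]
  rw [Finset.sum_range_succ, Finset.sum_range_one, h0, h1] at h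
  have h2 := Real.add_one_le_exp (s * ∫ ω, X ω ∂μ + 5 * s ^ 2)
  nlinarith [sq_nonneg s]

theorem integral_uniformPOVM_exp_le (hρ : IsDensityMatrix ρ) {v : EuclideanSpace ℂ (Fin d)}
    (hv : ‖v‖ = 1) {s : ℝ} (hs : |s| ≤ 1 / 4) :
    ∫ u, Real.exp (s * ((d + 1) * ‖inner ℂ v u.1‖ ^ 2 - (1 + quadForm ρ v))) ∂uniformPOVM ρ ≤
      Real.exp (5 * s ^ 2) := by
  have := isProbabilityMeasure_uniformPOVM hρ
  have h := integral_exp_mul_le_of_moments (μ := uniformPOVM ρ)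
    (X := fun u => (d + 1) * ‖inner ℂ v u.1‖ ^ 2) (fun u => by positivity)
    (fun k => integrable_of_continuous _ (by fun_prop))
    (integral_uniformPOVM_inner_pow_le hρ hv) hs
  rw [integral_uniformPOVM_inner_sq hρ hv, Real.exp_add] at h
  simp_rw [mul_sub, Real.exp_sub]
  rw [integral_div, div_le_iff₀ (Real.exp_pos _), mul_comm (Real.exp (5 * s ^ 2))]
  exact h

theorem isProbabilityMeasure_uniformPOVMCopies (hρ : IsDensityMatrix ρ) (n : ℕ) :
    IsProbabilityMeasure (uniformPOVMCopies ρ n) := by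
  have := isProbabilityMeasure_uniformPOVM hρ
  unfold uniformPOVMCopies
  infer_instance

/-- Chernoff bound for a sum of independent outcomes. -/
theorem uniformPOVMCopies_le_sum_le (hρ : IsDensityMatrix ρ) {v : EuclideanSpace ℂ (Fin d)}
    (hv : ‖v‖ = 1) {s : ℝ} (hs : |s| ≤ 1 / 4) (n : ℕ) (t : ℝ) :
    (uniformPOVMCopies ρ n).real
      {u | t ≤ s * ∑ i, ((d + 1) * ‖inner ℂ v (u i).1‖ ^ 2 - (1 + quadForm ρ v))} ≤
      Real.exp (n * (5 * s ^ 2) - t) := by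
  have := isProbabilityMeasure_uniformPOVM hρ
  have := isProbabilityMeasure_uniformPOVMCopies hρ n
  have hmean : ∫ u, ∏ i, Real.exp (s * ((d + 1) * ‖inner ℂ v (u i).1‖ ^ 2 - (1 + quadForm ρ v)))
      ∂uniformPOVMCopies ρ n ≤ Real.exp (n * (5 * s ^ 2)) := by
    rw [uniformPOVMCopies, integral_fintype_prod_eq_pow (ι := Fin n)
      (fun u : PureState d => Real.exp (s * ((d + 1) * ‖inner ℂ v u.1‖ ^ 2 - (1 + quadForm ρ v)))),
      Fintype.card_fin, Real.exp_nat_mul]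
    exact pow_le_pow_left₀ (integral_nonneg fun u => (Real.exp_pos _).le)
      (integral_uniformPOVM_exp_le hρ hv hs) n
  have hmarkov := mul_meas_ge_le_integral_of_nonneg (μ := uniformPOVMCopies ρ n)
    (f := fun u => ∏ i, Real.exp (s * ((d + 1) * ‖inner ℂ v (u i).1‖ ^ 2 - (1 + quadForm ρ v))))
    (.of_forall fun u => Finset.prod_nonneg fun i _ => (Real.exp_pos _).le)
    (integrable_of_continuous _ (by fun_prop)) (Real.exp t)
  have hset : {u : Fin n → PureState d | Real.exp t ≤
      ∏ i, Real.exp (s * ((d + 1) * ‖inner ℂ v (u i).1‖ ^ 2 - (1 + quadForm ρ v)))} =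
      {u | t ≤ s * ∑ i, ((d + 1) * ‖inner ℂ v (u i).1‖ ^ 2 - (1 + quadForm ρ v))} := by
    ext u
    simp only [Set.mem_ofPred_eq, ← Real.exp_sum, Real.exp_le_exp, Finset.mul_sum]
  rw [hset] at hmarkov
  rw [Real.exp_sub, le_div_iff₀ (Real.exp_pos _), mul_comm]
  exact hmarkov.trans hmean

theorem quadForm_sub (A B : Matrix (Fin d) (Fin d) ℂ) (x : EuclideanSpace ℂ (Fin d)) :
    quadForm (A - B) x = quadForm A x - quadForm B x := by
  simp [quadForm]

theorem quadForm_estimate {n : ℕ} (u : Fin n → PureState d) {v : EuclideanSpace ℂ (Fin d)}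
    (hv : ‖v‖ = 1) :
    quadForm (estimate u) v = (1 / n) * ∑ i, ((d + 1) * ‖inner ℂ v (u i).1‖ ^ 2 - 1) := by
  have h1 : (inner ℂ v v : ℂ) = 1 := by simp [inner_self_eq_norm_sq_to_K, hv]
  have h : ∀ i, (inner ℂ v (Matrix.toEuclideanCLM (n := Fin d) (𝕜 := ℂ)
      (((d : ℂ) + 1) • ketbra (u i) - 1) v)).re = (d + 1) * ‖inner ℂ v (u i).1‖ ^ 2 - 1 := fun i => by
    have h2 : ((d : ℂ) + 1) = ((d + 1 : ℝ) : ℂ) := by push_cast; rfl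
    rw [map_sub, map_smul, map_one, ← quadForm_ketbra, quadForm, sub_apply,
      smul_apply, inner_sub_right, inner_smul_right, Complex.sub_re, h2, Complex.re_ofReal_mul,
      one_apply_eq_self, h1, Complex.one_re]
  simp_rw [← h]
  rw [quadForm, estimate, map_smul, map_sum, smul_apply, inner_smul_right, Complex.re_ofReal_mul,
    sum_apply, inner_sum, Complex.re_sum]

theorem quadForm_estimate_sub {n : ℕ} (hn : n ≠ 0) (u : Fin n → PureState d)
    {v : EuclideanSpace ℂ (Fin d)} (hv : ‖v‖ = 1) :
    n * quadForm (estimate u - ρ) v =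
      ∑ i, ((d + 1) * ‖inner ℂ v (u i).1‖ ^ 2 - (1 + quadForm ρ v)) := by
  have hn' : (n : ℝ) ≠ 0 := by exact_mod_cast hn
  rw [quadForm_sub, quadForm_estimate u hv, mul_sub, ← mul_assoc, mul_one_div_cancel hn', one_mul]
  simp_rw [← sub_sub]
  rw [Finset.sum_sub_distrib _ (fun _ => quadForm ρ v)]
  simp

theorem uniformPOVMCopies_le_abs_quadForm_le (hρ : IsDensityMatrix ρ)
    {v : EuclideanSpace ℂ (Fin d)} (hv : ‖v‖ = 1) {n : ℕ} (hn : n ≠ 0) {τ : ℝ} (hτ : 0 < τ)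
    (hτ' : τ ≤ 5 / 2) :
    (uniformPOVMCopies ρ n).real {u | τ ≤ |quadForm (estimate u - ρ) v|} ≤
      2 * Real.exp (-(n * τ ^ 2 / 20)) := by
  have := isProbabilityMeasure_uniformPOVMCopies hρ n
  -- s = τ/10 minimizes 5s² - sτ, with value -τ²/20; τ ≤ 5/2 keeps s in the admissible range. The
  -- lower tail uses -s.
  have hs : |τ / 10| ≤ 1 / 4 := by rw [abs_of_pos (by positivity)]; linarith
  have h1 := uniformPOVMCopies_le_sum_le hρ hv hs n (n * (τ ^ 2 / 10))
  have h2 := uniformPOVMCopies_le_sum_le hρ hv (s := -(τ / 10)) (by rwa [abs_neg]) n (n * (τ ^ 2 / 10))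
  have he : Real.exp (n * (5 * (τ / 10) ^ 2) - n * (τ ^ 2 / 10)) = Real.exp (-(n * τ ^ 2 / 20)) := by
    congr 1; ring
  have he2 : (-(τ / 10)) ^ 2 = (τ / 10) ^ 2 := by ring
  rw [he2, he] at h2
  rw [he] at h1
  rw [two_mul]
  refine (measureReal_mono ?_ (measure_ne_top _ _)).trans
    ((measureReal_union_le _ _).trans (add_le_add h1 h2))
  intro u hu
  have hn' : (0 : ℝ) < n := by exact_mod_cast Nat.pos_of_ne_zero hn
  rcases le_abs.1 (show τ ≤ |quadForm (estimate u - ρ) v| from hu) with h | h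
  · left
    rw [Set.mem_ofPred_eq, ← quadForm_estimate_sub hn u hv]
    nlinarith [mul_le_mul_of_nonneg_left h (mul_pos hn' hτ).le]
  · right
    rw [Set.mem_ofPred_eq, ← quadForm_estimate_sub hn u hv]
    nlinarith [mul_le_mul_of_nonneg_left h (mul_pos hn' hτ).le]

end

/-! ### Nets on the sphere and concentration in operator norm. -/

section

open scoped Function in
/-- Volumetric bound: a `1/4`-separated set in the unit ball has at most `9 ^ dim` elements. -/
theorem card_le_of_quarter_separated {E : Type*} [NormedAddCommGroup E] [NormedSpace ℝ E]
    [FiniteDimensional ℝ E] (s : Finset E) (hs : ∀ c ∈ s, ‖c‖ ≤ 1)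
    (h : ∀ c ∈ s, ∀ e ∈ s, c ≠ e → 1 / 4 ≤ ‖c - e‖) : s.card ≤ 9 ^ Module.finrank ℝ E := by
  borelize E
  let μ : Measure E := Measure.addHaar
  -- Disjoint balls of radius 1/8 inside a ball of radius 9/8: the ratio of radii is 9.
  have hdisj : Set.Pairwise (s : Set E) (Disjoint on fun c => Metric.ball c (1 / 8 : ℝ)) := by
    rintro c hc e he hce
    apply Metric.ball_disjoint_ball
    rw [dist_eq_norm]
    linarith [h c hc e he hce]
  have hsub : ⋃ c ∈ s, Metric.ball (c : E) (1 / 8 : ℝ) ⊆ Metric.ball (0 : E) (9 / 8 : ℝ) := by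
    refine Set.iUnion₂_subset fun x hx => Metric.ball_subset_ball' ?_
    rw [dist_zero_right]
    linarith [hs x hx]
  have hvol : (s.card : ℝ≥0∞) * ENNReal.ofReal ((1 / 8) ^ Module.finrank ℝ E) *
      μ (Metric.ball 0 1) ≤ ENNReal.ofReal ((9 / 8) ^ Module.finrank ℝ E) * μ (Metric.ball 0 1) := by
    calc
      _ = μ (⋃ c ∈ s, Metric.ball (c : E) (1 / 8 : ℝ)) := by
        rw [measure_biUnion_finset hdisj fun c _ => measurableSet_ball]
        simp only [μ.addHaar_ball_of_pos _ (show (0 : ℝ) < 1 / 8 by norm_num)]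
        simp only [Finset.sum_const, nsmul_eq_mul, mul_assoc]
      _ ≤ μ (Metric.ball (0 : E) (9 / 8 : ℝ)) := measure_mono hsub
      _ = _ := μ.addHaar_ball_of_pos _ (by norm_num)
  have hcard := (ENNReal.mul_le_mul_iff_left (Metric.measure_ball_pos _ _ zero_lt_one).ne'
    measure_ball_lt_top.ne).1 hvol
  have hreal : (s.card : ℝ) ≤ (9 : ℝ) ^ Module.finrank ℝ E := by
    have := ENNReal.toReal_le_of_le_ofReal (by positivity) hcard
    rw [ENNReal.toReal_mul, ENNReal.toReal_natCast, ENNReal.toReal_ofReal (by positivity)] at this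
    rw [div_pow, div_pow, one_pow, mul_one_div] at this
    exact (div_le_div_iff_of_pos_right (by positivity)).1 this
  exact_mod_cast hreal

/-- The unit sphere of a finite-dimensional normed space has a `1/4`-net with at most `9 ^ dim`
elements. -/
theorem exists_quarter_net_sphere (E : Type*) [NormedAddCommGroup E] [NormedSpace ℝ E]
    [FiniteDimensional ℝ E] : ∃ s : Finset E, (∀ c ∈ s, ‖c‖ = 1) ∧
      s.card ≤ 9 ^ Module.finrank ℝ E ∧ ∀ x : E, ‖x‖ = 1 → ∃ c ∈ s, ‖x - c‖ ≤ 1 / 4 := by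
  classical
  -- A separated set of largest cardinality, which exists by the volumetric bound, is a net: an
  -- uncovered point could be added to it.
  let P : ℕ → Prop := fun m => ∃ s : Finset E, (∀ c ∈ s, ‖c‖ = 1) ∧
    (∀ c ∈ s, ∀ e ∈ s, c ≠ e → 1 / 4 ≤ ‖c - e‖) ∧ s.card = m
  have hP : ∀ m, P m → m ≤ 9 ^ Module.finrank ℝ E := by
    rintro m ⟨s, h1, h2, rfl⟩
    exact card_le_of_quarter_separated s (fun c hc => (h1 c hc).le) h2
  have h0 : P 0 := ⟨∅, by simp, by simp, rfl⟩
  obtain ⟨s, h1, h2, h3⟩ := Nat.findGreatest_spec (Nat.zero_le (9 ^ Module.finrank ℝ E)) h0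
  refine ⟨s, h1, h3.trans_le (Nat.findGreatest_le _), fun x hx => ?_⟩
  by_contra! hcon
  have hxs : x ∉ s := fun hxs => by
    have := hcon x hxs
    rw [sub_self, norm_zero] at this
    linarith
  have hnew : P (s.card + 1) := by
    refine ⟨insert x s, ?_, ?_, Finset.card_insert_of_notMem hxs⟩
    · simpa [hx] using h1
    · intro c hc e he hce
      rcases Finset.mem_insert.1 hc with rfl | hc' <;> rcases Finset.mem_insert.1 he with rfl | he'
      · exact absurd rfl hce
      · exact (hcon e he').le
      · rw [norm_sub_rev]; exact (hcon c hc').le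
      · exact h2 c hc' e he' hce
  have := Nat.le_findGreatest (hP _ hnew) hnew
  omega

variable {d : ℕ}

theorem opNorm_le_of_abs_quadForm_le {A : Matrix (Fin d) (Fin d) ℂ} (hA : A.IsHermitian) {c : ℝ}
    (hc : 0 ≤ c) (h : ∀ x, ‖x‖ = 1 → |quadForm A x| ≤ c) : opNorm A ≤ c := by
  set T := Matrix.toEuclideanCLM (n := Fin d) (𝕜 := ℂ) A with hT
  have hsymm : (T : EuclideanSpace ℂ (Fin d) →ₗ[ℂ] EuclideanSpace ℂ (Fin d)).IsSymmetric :=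
    isSymmetric_toEuclideanCLM hA
  rw [opNorm, ← hT, T.norm_eq_iSup_rayleighQuotient hsymm]
  refine Real.iSup_le (fun x => ?_) hc
  rcases eq_or_ne x 0 with rfl | hx
  · simpa [ContinuousLinearMap.rayleighQuotient] using hc
  · have hx' : ‖x‖ ≠ 0 := norm_ne_zero_iff.2 hx
    have hn : ‖((‖x‖⁻¹ : ℝ) : ℂ) • x‖ = 1 := by
      rw [norm_smul, Complex.norm_real, norm_inv, norm_norm, inv_mul_cancel₀ hx']
    rw [← T.rayleigh_smul x (c := ((‖x‖⁻¹ : ℝ) : ℂ)) (by simpa using hx)]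
    rw [ContinuousLinearMap.rayleighQuotient, T.reApplyInnerSelf_apply, hsymm.apply_clm, hn,
      one_pow, div_one]
    exact h _ hn

theorem abs_quadForm_le (A : Matrix (Fin d) (Fin d) ℂ) (x : EuclideanSpace ℂ (Fin d)) :
    |quadForm A x| ≤ opNorm A * ‖x‖ ^ 2 := by
  refine (Complex.abs_re_le_norm _).trans ((norm_inner_le_norm _ _).trans ?_)
  calc
    _ ≤ ‖x‖ * (opNorm A * ‖x‖) := by
      gcongr
      exact ContinuousLinearMap.le_opNorm _ _
    _ = _ := by ring

theorem abs_quadForm_sub_le {A : Matrix (Fin d) (Fin d) ℂ} {x y : EuclideanSpace ℂ (Fin d)}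
    (hx : ‖x‖ = 1) (hy : ‖y‖ = 1) :
    |quadForm A x - quadForm A y| ≤ 2 * opNorm A * ‖x - y‖ := by
  set T := Matrix.toEuclideanCLM (n := Fin d) (𝕜 := ℂ) A with hT
  have h : quadForm A x - quadForm A y =
      (inner ℂ (x - y) (T x)).re + (inner ℂ y (T (x - y))).re := by
    simp only [quadForm, ← hT, inner_sub_left, map_sub, inner_sub_right, Complex.sub_re]
    ring
  have h1 : |(inner ℂ (x - y) (T x)).re| ≤ ‖x - y‖ * opNorm A :=
    (Complex.abs_re_le_norm _).trans ((norm_inner_le_norm _ _).trans (by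
      gcongr; exact (T.le_opNorm x).trans_eq (by rw [hx, mul_one]; rfl)))
  have h2 : |(inner ℂ y (T (x - y))).re| ≤ opNorm A * ‖x - y‖ :=
    (Complex.abs_re_le_norm _).trans ((norm_inner_le_norm _ _).trans (by
      rw [hy, one_mul]; exact T.le_opNorm _))
  rw [h]
  refine (abs_add_le _ _).trans ?_
  linarith

/-- The norm of a Hermitian matrix is controlled by its quadratic form on a `1/4`-net. -/
theorem opNorm_le_of_net {A : Matrix (Fin d) (Fin d) ℂ} (hA : A.IsHermitian)
    {s : Finset (EuclideanSpace ℂ (Fin d))} (hs : ∀ c ∈ s, ‖c‖ = 1)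
    (hnet : ∀ x : EuclideanSpace ℂ (Fin d), ‖x‖ = 1 → ∃ c ∈ s, ‖x - c‖ ≤ 1 / 4) {τ : ℝ}
    (hτ : 0 ≤ τ) (h : ∀ c ∈ s, |quadForm A c| ≤ τ) : opNorm A ≤ 2 * τ := by
  have h0 : 0 ≤ opNorm A := norm_nonneg _
  -- Moving to the net costs 2 · (1/4) times the norm, which the left side absorbs.
  have key : opNorm A ≤ τ + opNorm A / 2 := by
    refine opNorm_le_of_abs_quadForm_le hA (by positivity) fun x hx => ?_
    obtain ⟨c, hc, hxc⟩ := hnet x hx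
    have h1 := abs_quadForm_sub_le (A := A) hx (hs c hc)
    have h2 := abs_sub_abs_le_abs_sub (quadForm A x) (quadForm A c)
    have h3 := mul_le_mul_of_nonneg_left hxc h0
    linarith [h c hc]
  linarith

theorem isHermitian_estimate_sub {ρ : Matrix (Fin d) (Fin d) ℂ} (hρ : ρ.IsHermitian) {n : ℕ}
    (u : Fin n → PureState d) : (estimate u - ρ).IsHermitian :=
  (isHermitian_estimate u).sub hρ

theorem continuous_quadForm_estimate_sub {ρ : Matrix (Fin d) (Fin d) ℂ} {n : ℕ} (hn : n ≠ 0)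
    {v : EuclideanSpace ℂ (Fin d)} (hv : ‖v‖ = 1) :
    Continuous fun u : Fin n → PureState d => quadForm (estimate u - ρ) v := by
  have hn' : (n : ℝ) ≠ 0 := by exact_mod_cast hn
  have : (fun u : Fin n → PureState d => quadForm (estimate u - ρ) v) = fun u =>
      (n : ℝ)⁻¹ * ∑ i, ((d + 1) * ‖inner ℂ v (u i).1‖ ^ 2 - (1 + quadForm ρ v)) := by
    ext u
    rw [← quadForm_estimate_sub hn u hv, inv_mul_cancel_left₀ hn']
  rw [this]
  fun_prop

/-- Concentration of uniform POVM tomography in operator norm. -/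
theorem exists_opNorm_estimate_sub_le {ρ : Matrix (Fin d) (Fin d) ℂ} (hρ : IsDensityMatrix ρ)
    {n : ℕ} {τ : ℝ} (hτ : 0 < τ) (hτ' : τ ≤ 5 / 2) (hn : 200 * d ≤ n * τ ^ 2) :
    ∃ E : Set (Fin n → PureState d), MeasurableSet E ∧
      (99 / 100 : ℝ≥0∞) ≤ uniformPOVMCopies ρ n E ∧ ∀ u ∈ E, opNorm (estimate u - ρ) ≤ 2 * τ := by
  have := isProbabilityMeasure_uniformPOVMCopies hρ n
  have := hρ.neZero
  have hd : (1 : ℝ) ≤ d := by exact_mod_cast Nat.one_le_iff_ne_zero.2 (NeZero.ne d)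
  have hn0 : n ≠ 0 := by
    rintro rfl
    rw [Nat.cast_zero, zero_mul] at hn
    linarith
  obtain ⟨s, hs, hcard, hnet⟩ := exists_quarter_net_sphere (EuclideanSpace ℂ (Fin d))
  have hfin : Module.finrank ℝ (EuclideanSpace ℂ (Fin d)) = 2 * d := by
    rw [finrank_real_of_complex]; simp
  rw [hfin, pow_mul] at hcard
  let bad : EuclideanSpace ℂ (Fin d) → Set (Fin n → PureState d) :=
    fun c => {u | τ ≤ |quadForm (estimate u - ρ) c|}
  -- The good event is defined through the net, so its measurability needs only finitely many closed
  -- conditions.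
  have hmeas : MeasurableSet (⋃ c ∈ s, bad c) :=
    s.measurableSet_biUnion fun c hc => (isClosed_le continuous_const
      (continuous_quadForm_estimate_sub hn0 (hs c hc)).abs).measurableSet
  -- The constant 200 makes each tail at most 2e^(-10d), which beats the 81^d net points (real
  -- dimension 2d).
  have hexp : Real.exp (-(n * τ ^ 2 / 20)) ≤ Real.exp (-10) ^ d := by
    rw [← Real.exp_nat_mul, Real.exp_le_exp]
    linarith
  have hprob : (uniformPOVMCopies ρ n).real (⋃ c ∈ s, bad c) ≤ 1 / 100 := by
    calc
      _ ≤ ∑ c ∈ s, (uniformPOVMCopies ρ n).real (bad c) := measureReal_biUnion_finset_le _ _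
      _ ≤ ∑ c ∈ s, 2 * Real.exp (-10) ^ d := Finset.sum_le_sum fun c hc =>
        (uniformPOVMCopies_le_abs_quadForm_le hρ (hs c hc) hn0 hτ hτ').trans (by linarith)
      _ = s.card * (2 * Real.exp (-10) ^ d) := by rw [Finset.sum_const, nsmul_eq_mul]
      _ ≤ ((9 ^ 2) ^ d : ℕ) * (2 * Real.exp (-10) ^ d) := by gcongr
      _ = 2 * (81 * Real.exp (-10)) ^ d := by push_cast; rw [mul_pow]; ring
      _ ≤ 2 * (1 / 200) ^ d := by
        have : 81 * Real.exp (-10) ≤ 1 / 200 := by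
          have h1 := Real.exp_one_gt_d9
          have h2 : Real.exp (-10) = (Real.exp 1 ^ 10)⁻¹ := by
            rw [← Real.exp_nat_mul, ← Real.exp_neg]; norm_num
          have h3 : (2.7 : ℝ) ^ 10 ≤ Real.exp 1 ^ 10 := by gcongr; linarith
          rw [h2, ← div_eq_mul_inv, div_le_iff₀ (by positivity)]
          norm_num at h3 ⊢
          linarith
        gcongr
      _ ≤ 2 * (1 / 200) ^ 1 := by
        gcongr ?_ * ?_
        exact pow_le_pow_of_le_one (by norm_num) (by norm_num) (by exact_mod_cast hd)
      _ = 1 / 100 := by norm_num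
  refine ⟨(⋃ c ∈ s, bad c)ᶜ, hmeas.compl, ?_, fun u hu => ?_⟩
  · have h := probReal_compl_eq_one_sub (μ := uniformPOVMCopies ρ n) hmeas
    rw [← ENNReal.toReal_le_toReal (by finiteness) (measure_ne_top _ _), ← Measure.real, h]
    simp
    linarith
  · refine opNorm_le_of_net (isHermitian_estimate_sub hρ.posSemidef.isHermitian u) hs hnet hτ.le
      fun c hc => ?_
    by_contra! hcon
    exact hu (Set.mem_biUnion hc hcon.le)

end

/-! ### Weyl's inequality and comparison of spectra. -/

section

variable {d : ℕ} {A : Matrix (Fin d) (Fin d) ℂ}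

/-- The permutation that sorts the eigenvalues of a Hermitian matrix. -/
noncomputable def specEquiv (d : ℕ) : Fin d ≃ Fin d :=
  (finCongr (Fintype.card_fin d).symm).trans (Fintype.equivOfCardEq (Fintype.card_fin _))

theorem spec_eq (hA : A.IsHermitian) (i : Fin d) : spec hA i = hA.eigenvalues (specEquiv d i) := by
  simp [spec, Matrix.IsHermitian.eigenvalues, specEquiv]

theorem spec_antitone (hA : A.IsHermitian) : Antitone (spec hA) :=
  fun _ _ h => hA.eigenvalues₀_antitone h

theorem sum_spec (hA : A.IsHermitian) : ∑ i, spec hA i = A.trace.re := by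
  simp_rw [spec_eq]
  rw [Equiv.sum_comp (specEquiv d) hA.eigenvalues, hA.trace_eq_sum_eigenvalues]
  simp

theorem quadForm_eq_sum_spec (hA : A.IsHermitian) (x : EuclideanSpace ℂ (Fin d)) :
    quadForm A x = ∑ i, spec hA i * ‖inner ℂ (hA.eigenvectorBasis (specEquiv d i)) x‖ ^ 2 := by
  simp_rw [spec_eq]
  rw [quadForm_eq_sum hA, Equiv.sum_comp (specEquiv d)
    fun j => hA.eigenvalues j * ‖inner ℂ (hA.eigenvectorBasis j) x‖ ^ 2]

theorem sum_norm_inner_specEquiv_sq (hA : A.IsHermitian) (x : EuclideanSpace ℂ (Fin d)) :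
    ∑ i, ‖inner ℂ (hA.eigenvectorBasis (specEquiv d i)) x‖ ^ 2 = ‖x‖ ^ 2 := by
  rw [Equiv.sum_comp (specEquiv d) fun j => ‖inner ℂ (hA.eigenvectorBasis j) x‖ ^ 2]
  exact hA.eigenvectorBasis.sum_sq_norm_inner_right x

/-- **Weyl's inequality**: a bound on quadratic forms gives a bound on each sorted eigenvalue. -/
theorem spec_le_spec_add {A' : Matrix (Fin d) (Fin d) ℂ} (hA : A.IsHermitian)
    (hA' : A'.IsHermitian) {δ : ℝ} (h : ∀ x, quadForm A x ≤ quadForm A' x + δ * ‖x‖ ^ 2)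
    (i : Fin d) : spec hA i ≤ spec hA' i + δ := by
  let a := fun k => hA.eigenvectorBasis (specEquiv d k)
  let b := fun k => hA'.eigenvectorBasis (specEquiv d k)
  -- Dimension count: only d - 1 conditions are imposed, since coordinate `i` of `L` is zero. A
  -- nonzero kernel vector lies in the span of the a_k with k ≤ i and of the b_k with k ≥ i, so its
  -- two quadratic forms compare the i-th eigenvalues.
  let L : EuclideanSpace ℂ (Fin d) →ₗ[ℂ] (Fin d → ℂ) := LinearMap.pi fun k =>
    if k < i then (innerSL ℂ (b k) : EuclideanSpace ℂ (Fin d) →ₗ[ℂ] ℂ)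
    else if i < k then (innerSL ℂ (a k) : EuclideanSpace ℂ (Fin d) →ₗ[ℂ] ℂ) else 0
  have hL : ¬ Function.Injective L := by
    rw [LinearMap.injective_iff_surjective_of_finrank_eq_finrank (by simp)]
    intro hsurj
    obtain ⟨x, hx⟩ := hsurj (Pi.single i 1)
    have := congrFun hx i
    simp [L] at this
  rw [← LinearMap.ker_eq_bot, Submodule.eq_bot_iff] at hL
  push Not at hL
  obtain ⟨x, hx, hx0⟩ := hL
  have hker : ∀ k, L x k = 0 := fun k => congrFun (LinearMap.mem_ker.1 hx) k
  have hb : ∀ k, k < i → inner ℂ (b k) x = 0 := fun k hk => by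
    simpa [L, hk] using hker k
  have ha : ∀ k, i < k → inner ℂ (a k) x = 0 := fun k hk => by
    simpa [L, hk, hk.not_gt] using hker k
  have h1 : spec hA i * ‖x‖ ^ 2 ≤ quadForm A x := by
    rw [quadForm_eq_sum_spec hA, ← sum_norm_inner_specEquiv_sq hA, Finset.mul_sum]
    refine Finset.sum_le_sum fun k _ => ?_
    rcases lt_or_ge i k with hk | hk
    · rw [show inner ℂ (hA.eigenvectorBasis (specEquiv d k)) x = 0 from ha k hk]
      simp
    · exact mul_le_mul_of_nonneg_right (spec_antitone hA hk) (sq_nonneg _)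
  have h2 : quadForm A' x ≤ spec hA' i * ‖x‖ ^ 2 := by
    rw [quadForm_eq_sum_spec hA', ← sum_norm_inner_specEquiv_sq hA', Finset.mul_sum]
    refine Finset.sum_le_sum fun k _ => ?_
    rcases lt_or_ge k i with hk | hk
    · rw [show inner ℂ (hA'.eigenvectorBasis (specEquiv d k)) x = 0 from hb k hk]
      simp
    · exact mul_le_mul_of_nonneg_right (spec_antitone hA' hk) (sq_nonneg _)
  have hpos : 0 < ‖x‖ ^ 2 := by positivity
  have h3 := h x
  refine le_of_mul_le_mul_right ?_ hpos
  linarith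

theorem abs_spec_sub_le {A' : Matrix (Fin d) (Fin d) ℂ} (hA : A.IsHermitian)
    (hA' : A'.IsHermitian) (i : Fin d) : |spec hA i - spec hA' i| ≤ opNorm (A - A') := by
  have hq : ∀ x, |quadForm A x - quadForm A' x| ≤ opNorm (A - A') * ‖x‖ ^ 2 := fun x => by
    rw [← quadForm_sub]; exact abs_quadForm_le _ x
  have h1 := spec_le_spec_add hA hA' (δ := opNorm (A - A'))
    (fun x => by linarith [(abs_le.1 (hq x)).2]) i
  have h2 := spec_le_spec_add hA' hA (δ := opNorm (A - A'))
    (fun x => by linarith [(abs_le.1 (hq x)).1]) i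
  rw [abs_le]
  constructor <;> linarith

theorem quadForm_eq_dotProduct (M : Matrix (Fin d) (Fin d) ℂ) (x : EuclideanSpace ℂ (Fin d)) :
    quadForm M x = (star x.ofLp ⬝ᵥ M.mulVec x.ofLp).re := by
  rw [quadForm, EuclideanSpace.inner_eq_star_dotProduct, Matrix.ofLp_toEuclideanCLM,
    dotProduct_comm]

theorem quadForm_nonneg (hA : A.PosSemidef) (x : EuclideanSpace ℂ (Fin d)) : 0 ≤ quadForm A x := by
  rw [quadForm_eq_dotProduct]
  exact (Complex.le_def.1 (hA.dotProduct_mulVec_nonneg x.ofLp)).1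

theorem posSemidef_of_quadForm_nonneg (hA : A.IsHermitian) (h : ∀ x, 0 ≤ quadForm A x) :
    A.PosSemidef := by
  rw [hA.posSemidef_iff_eigenvalues_nonneg]
  intro j
  have := h (hA.eigenvectorBasis j)
  rw [quadForm, toEuclideanCLM_eigenvectorBasis, inner_smul_right, Complex.re_ofReal_mul] at this
  simpa using this

/-- If `M` dominates both `A` and `A'`, the `ℓ¹` distance of the spectra is bounded by traces. -/
theorem sum_abs_spec_sub_le_of_posSemidef {A' M : Matrix (Fin d) (Fin d) ℂ} (hA : A.IsHermitian)
    (hA' : A'.IsHermitian) (hM : (M - A).PosSemidef) (hM' : (M - A').PosSemidef) :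
    ∑ i, |spec hA i - spec hA' i| ≤ (M - A).trace.re + (M - A').trace.re := by
  have hMh : M.IsHermitian := by simpa using hM.isHermitian.add hA
  -- Both spectra lie entrywise below that of `M`, so the two gaps sum to traces.
  have h1 : ∀ i, spec hA i ≤ spec hMh i := fun i => by
    simpa using spec_le_spec_add hA hMh (δ := 0)
      (fun x => by linarith [quadForm_nonneg hM x, quadForm_sub M A x]) i
  have h2 : ∀ i, spec hA' i ≤ spec hMh i := fun i => by
    simpa using spec_le_spec_add hA' hMh (δ := 0)
      (fun x => by linarith [quadForm_nonneg hM' x, quadForm_sub M A' x]) i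
  calc
    _ ≤ ∑ i, ((spec hMh i - spec hA i) + (spec hMh i - spec hA' i)) := by
      refine Finset.sum_le_sum fun i _ => ?_
      rw [abs_le]
      constructor <;> linarith [h1 i, h2 i]
    _ = _ := by
      rw [Finset.sum_add_distrib, Finset.sum_sub_distrib, Finset.sum_sub_distrib, sum_spec,
        sum_spec, sum_spec, Matrix.trace_sub, Matrix.trace_sub, Complex.sub_re, Complex.sub_re]

/-! ### Pinching by a projector. -/

section Projection

variable {P ρ σ : Matrix (Fin d) (Fin d) ℂ}

theorem one_sub_isIdempotent (hP : P * P = P) : (1 - P) * (1 - P) = 1 - P := by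
  rw [mul_sub, mul_one, sub_mul, one_mul, hP, sub_self, sub_zero]

theorem quadForm_conj (hP : P.IsHermitian) (M : Matrix (Fin d) (Fin d) ℂ)
    (x : EuclideanSpace ℂ (Fin d)) : quadForm (P * M * P) x =
      quadForm M (Matrix.toEuclideanCLM (n := Fin d) (𝕜 := ℂ) P x) := by
  rw [quadForm, quadForm, isSymmetric_toEuclideanCLM hP, map_mul, map_mul]
  rfl

theorem norm_toEuclideanCLM_sq (hP : P.IsHermitian) (hPP : P * P = P)
    (x : EuclideanSpace ℂ (Fin d)) :
    ‖Matrix.toEuclideanCLM (n := Fin d) (𝕜 := ℂ) P x‖ ^ 2 = quadForm P x := by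
  rw [quadForm, @norm_sq_eq_re_inner ℂ, isSymmetric_toEuclideanCLM hP,
    ← mul_apply_eq_comp, ← map_mul, hPP]
  rfl

theorem quadForm_one (x : EuclideanSpace ℂ (Fin d)) :
    quadForm (1 : Matrix (Fin d) (Fin d) ℂ) x = ‖x‖ ^ 2 := by
  rw [quadForm, map_one, @norm_sq_eq_re_inner ℂ]
  rfl

theorem norm_sq_one_sub_toEuclideanCLM_le (hP : P.IsHermitian) (hPP : P * P = P)
    (x : EuclideanSpace ℂ (Fin d)) :
    ‖Matrix.toEuclideanCLM (n := Fin d) (𝕜 := ℂ) (1 - P) x‖ ^ 2 ≤ ‖x‖ ^ 2 := by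
  rw [norm_toEuclideanCLM_sq (Matrix.isHermitian_one.sub hP) (one_sub_isIdempotent hPP),
    quadForm_sub, quadForm_one, ← norm_toEuclideanCLM_sq hP hPP]
  linarith [sq_nonneg ‖Matrix.toEuclideanCLM (n := Fin d) (𝕜 := ℂ) P x‖]

theorem trace_pinch (hPP : P * P = P) : (pinch P ρ).trace = ρ.trace := by
  rw [pinch, Matrix.trace_add, Matrix.trace_mul_cycle, hPP, Matrix.trace_mul_cycle,
    one_sub_isIdempotent hPP, ← Matrix.trace_add, ← add_mul, add_sub_cancel, one_mul]

/-- A matrix commuting with `P` has no off-diagonal blocks, so only the error ρ - σ contributes. -/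
theorem sub_pinch (hPσ : P * σ = σ * P) (hPP : P * P = P) :
    ρ - pinch P ρ = P * (ρ - σ) * (1 - P) + (1 - P) * (ρ - σ) * P := by
  have h1 : P * σ * (1 - P) = 0 := by
    rw [hPσ, mul_assoc, mul_sub, mul_one, hPP, sub_self, mul_zero]
  have h2 : (1 - P) * σ * P = 0 := by
    rw [mul_assoc, ← hPσ, ← mul_assoc, sub_mul, one_mul, hPP, sub_self, zero_mul]
  rw [mul_sub P ρ σ, mul_sub (1 - P) ρ σ, sub_mul (P * ρ), sub_mul ((1 - P) * ρ), h1, h2, pinch]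
  noncomm_ring

/-- Pinching with a projector of trace `r` that commutes with a `δ`-approximation of `ρ` moves the
spectrum by at most `2 r δ` in total variation. -/
theorem dTV_spec_pinch_le (hP : P.IsHermitian) (hPP : P * P = P) (hPσ : P * σ = σ * P)
    (hρ : ρ.IsHermitian) (hσ : σ.IsHermitian) {δ : ℝ} (hδ : 0 < δ) (hop : opNorm (ρ - σ) ≤ δ) :
    dTV (spec (isHermitian_pinch hP hρ)) (spec hρ) ≤ 2 * P.trace.re * δ := by
  set D := ρ - σ with hDdef
  have hD : D.IsHermitian := hρ.sub hσ
  have hQ : (1 - P).IsHermitian := Matrix.isHermitian_one.sub hP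
  have hQQ := one_sub_isIdempotent hPP
  set Q := 1 - P with hQdef
  let c : ℂ := (δ : ℂ)
  have hc0 : c ≠ 0 := Complex.ofReal_ne_zero.2 hδ.ne'
  have hc : star c = c := Complex.conj_ofReal δ
  have hcpos : 0 ≤ c := Complex.zero_le_real.2 hδ.le
  have hcinv : 0 ≤ c⁻¹ := by rw [← Complex.ofReal_inv]; exact Complex.zero_le_real.2 (by positivity)
  -- `N` completes the square: added to the off-diagonal part PDQ + QDP it gives c⁻¹(cP + QDP)(cP +
  -- QDP)*. The choice c = δ makes the bounds on the two traces in `N` equal.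
  let N := c • P + c⁻¹ • (Q * D * P * (P * D * Q))
  have hY : (Q * D * P).conjTranspose = P * D * Q := by
    rw [Matrix.conjTranspose_mul, Matrix.conjTranspose_mul, hQ.eq, hD.eq, hP.eq, mul_assoc]
  have hPpsd : P.PosSemidef := by
    have := Matrix.posSemidef_self_mul_conjTranspose P
    rwa [hP.eq, hPP] at this
  have hN : N.PosSemidef := by
    refine (hPpsd.smul hcpos).add (Matrix.PosSemidef.smul ?_ hcinv)
    rw [← hY]
    exact Matrix.posSemidef_self_mul_conjTranspose _
  have hK : ρ + N - pinch P ρ = c⁻¹ • ((c • P + Q * D * P) * (c • P + Q * D * P).conjTranspose) := by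
    have h1 : ρ + N - pinch P ρ = (ρ - pinch P ρ) + N := by abel
    rw [h1, sub_pinch hPσ hPP, Matrix.conjTranspose_add, hY, Matrix.conjTranspose_smul, hP.eq, hc,
      add_mul, mul_add, mul_add, smul_mul_smul_comm, hPP, smul_mul_assoc, mul_smul_comm]
    have h2 : P * (P * D * Q) = P * D * Q := by rw [← mul_assoc, ← mul_assoc, hPP]
    have h3 : Q * D * P * P = Q * D * P := by rw [mul_assoc, hPP]
    rw [h2, h3]
    simp only [N, smul_add, smul_smul, inv_mul_cancel₀ hc0, one_smul, inv_mul_cancel_left₀ hc0]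
    abel
  have hMρ : (ρ + N - ρ).PosSemidef := by rwa [add_sub_cancel_left]
  have hMpinch : (ρ + N - pinch P ρ).PosSemidef := by
    rw [hK]
    exact (Matrix.posSemidef_self_mul_conjTranspose _).smul hcinv
  have hsum := sum_abs_spec_sub_le_of_posSemidef (isHermitian_pinch hP hρ) hρ hMpinch hMρ
  have htr1 : (ρ + N - pinch P ρ).trace = N.trace := by
    rw [Matrix.trace_sub, Matrix.trace_add, trace_pinch hPP, add_sub_cancel_left]
  rw [htr1, add_sub_cancel_left] at hsum
  -- DQD ≤ D² ≤ δ², compressed by `P`; the trace of the second term of `N` is thus bounded by the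
  -- rank of `P`, not by d.
  have hcomp : ((c * c) • P - P * D * Q * (Q * D * P)).PosSemidef := by
    have heq : (c * c) • P - P * D * Q * (Q * D * P) = P.conjTranspose * ((c * c) • 1 - D * Q * D) * P := by
      have : P * D * Q * (Q * D * P) = P * (D * Q * D) * P := by
        calc _ = P * D * (Q * Q) * D * P := by simp only [mul_assoc]
          _ = _ := by rw [hQQ]; simp only [mul_assoc]
      rw [this, hP.eq, mul_sub P ((c * c) • 1) (D * Q * D), sub_mul (P * ((c * c) • 1)),
        mul_smul_comm, mul_one, smul_mul_assoc, hPP]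
    rw [heq]
    refine Matrix.PosSemidef.conjTranspose_mul_mul_same (posSemidef_of_quadForm_nonneg ?_ ?_) P
    · refine Matrix.IsHermitian.sub ?_ ?_
      · rw [Matrix.IsHermitian, Matrix.conjTranspose_smul, Matrix.conjTranspose_one, star_mul, hc]
      · rw [Matrix.IsHermitian, Matrix.conjTranspose_mul, Matrix.conjTranspose_mul, hQ.eq, hD.eq,
          mul_assoc]
    · intro x
      have hx : quadForm ((c * c) • (1 : Matrix (Fin d) (Fin d) ℂ)) x = δ ^ 2 * ‖x‖ ^ 2 := by
        rw [← quadForm_one, quadForm, map_smul, smul_apply, inner_smul_right,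
          show c * c = ((δ ^ 2 : ℝ) : ℂ) by push_cast; ring, Complex.re_ofReal_mul]
        rfl
      rw [quadForm_sub, hx, quadForm_conj hD, ← norm_toEuclideanCLM_sq hQ hQQ, sub_nonneg,
        ← mul_pow]
      refine (norm_sq_one_sub_toEuclideanCLM_le hP hPP _).trans ?_
      gcongr
      exact (ContinuousLinearMap.le_opNorm _ x).trans (by gcongr; exact hop)
  have htr2 : (Q * D * P * (P * D * Q)).trace.re ≤ δ ^ 2 * P.trace.re := by
    have h := (Complex.le_def.1 hcomp.trace_nonneg).1
    rw [Matrix.trace_sub, Matrix.trace_smul, Matrix.trace_mul_comm, smul_eq_mul,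
      show c * c = ((δ ^ 2 : ℝ) : ℂ) by push_cast; ring, Complex.sub_re, Complex.re_ofReal_mul,
      Complex.zero_re] at h
    linarith
  have htrN : N.trace.re ≤ 2 * δ * P.trace.re := by
    have : N.trace.re = δ * P.trace.re + δ⁻¹ * (Q * D * P * (P * D * Q)).trace.re := by
      simp only [N, c, Matrix.trace_add, Matrix.trace_smul, smul_eq_mul, Complex.add_re,
        ← Complex.ofReal_inv, Complex.re_ofReal_mul]
    rw [this]
    have h1 : δ⁻¹ * (Q * D * P * (P * D * Q)).trace.re ≤ δ⁻¹ * (δ ^ 2 * P.trace.re) := by gcongr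
    have h2 : δ⁻¹ * (δ ^ 2 * P.trace.re) = δ * P.trace.re := by field_simp
    linarith
  rw [dTV]
  linarith

end Projection

/-! ### Spectral threshold projectors. -/

section Threshold

variable (hA : A.IsHermitian) (B : ℝ)

theorem thresholdProj_eq : thresholdProj hA B = (hA.eigenvectorUnitary : Matrix (Fin d) (Fin d) ℂ) *
    Matrix.diagonal (fun j => if B ≤ hA.eigenvalues j then 1 else 0) *
      star (hA.eigenvectorUnitary : Matrix (Fin d) (Fin d) ℂ) := by
  ext i k
  rw [thresholdProj, Matrix.sum_apply, Matrix.mul_apply]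
  refine Finset.sum_congr rfl fun j _ => ?_
  rw [Matrix.mul_diagonal]
  split_ifs <;> simp [Matrix.vecMulVec_apply]

theorem thresholdProj_mul_self : thresholdProj hA B * thresholdProj hA B = thresholdProj hA B := by
  have hU : star (hA.eigenvectorUnitary : Matrix (Fin d) (Fin d) ℂ) *
      (hA.eigenvectorUnitary : Matrix (Fin d) (Fin d) ℂ) = 1 := Unitary.coe_star_mul_self _
  rw [thresholdProj_eq]
  set U := (hA.eigenvectorUnitary : Matrix (Fin d) (Fin d) ℂ)
  set X := Matrix.diagonal fun j => if B ≤ hA.eigenvalues j then (1 : ℂ) else 0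
  calc U * X * star U * (U * X * star U) = U * X * (star U * U) * X * star U := by
        simp only [mul_assoc]
    _ = U * (X * X) * star U := by rw [hU, mul_one]; simp only [mul_assoc]
    _ = _ := by
      congr 2
      rw [Matrix.diagonal_mul_diagonal]
      congr 1
      ext j
      split_ifs <;> simp

theorem thresholdProj_mul_comm : thresholdProj hA B * A = A * thresholdProj hA B := by
  have hU : star (hA.eigenvectorUnitary : Matrix (Fin d) (Fin d) ℂ) *
      (hA.eigenvectorUnitary : Matrix (Fin d) (Fin d) ℂ) = 1 := Unitary.coe_star_mul_self _
  have hspec : A = (hA.eigenvectorUnitary : Matrix (Fin d) (Fin d) ℂ) *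
    Matrix.diagonal (RCLike.ofReal ∘ hA.eigenvalues) *
      star (hA.eigenvectorUnitary : Matrix (Fin d) (Fin d) ℂ) := by
    conv_lhs => rw [hA.spectral_theorem, Unitary.conjStarAlgAut_apply]
  rw [thresholdProj_eq]
  set U := (hA.eigenvectorUnitary : Matrix (Fin d) (Fin d) ℂ)
  set X := Matrix.diagonal fun j => if B ≤ hA.eigenvalues j then (1 : ℂ) else 0
  set Y : Matrix (Fin d) (Fin d) ℂ := Matrix.diagonal (RCLike.ofReal ∘ hA.eigenvalues)
  have hXY : X * Y = Y * X := by
    rw [Matrix.diagonal_mul_diagonal, Matrix.diagonal_mul_diagonal]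
    congr 1
    ext j
    rw [mul_comm]
  calc U * X * star U * A = U * X * (star U * U) * Y * star U := by
        rw [hspec]; simp only [mul_assoc]
    _ = U * (X * Y) * star U := by rw [hU, mul_one]; simp only [mul_assoc]
    _ = U * Y * (star U * U) * X * star U := by rw [hXY, hU, mul_one]; simp only [mul_assoc]
    _ = _ := by rw [hspec]; simp only [mul_assoc]

theorem rank_thresholdProj_eq_card_eigenvalues :
    (thresholdProj hA B).rank = (Finset.univ.filter fun j => B ≤ hA.eigenvalues j).card := by
  rw [thresholdProj_eq, ← Unitary.coe_star]
  simp [-isUnit_iff_ne_zero, -Unitary.coe_star, Matrix.rank_diagonal, Fintype.card_subtype]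

theorem rank_thresholdProj :
    (thresholdProj hA B).rank = (Finset.univ.filter fun i => B ≤ spec hA i).card := by
  rw [rank_thresholdProj_eq_card_eigenvalues]
  simp_rw [spec_eq]
  exact (Finset.card_equiv (specEquiv d) fun i => by simp).symm

theorem trace_thresholdProj : (thresholdProj hA B).trace = (thresholdProj hA B).rank := by
  have hU : star (hA.eigenvectorUnitary : Matrix (Fin d) (Fin d) ℂ) *
      (hA.eigenvectorUnitary : Matrix (Fin d) (Fin d) ℂ) = 1 := Unitary.coe_star_mul_self _
  rw [rank_thresholdProj_eq_card_eigenvalues, thresholdProj_eq, Matrix.trace_mul_cycle, hU,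
    one_mul, Matrix.trace_diagonal]
  simp

theorem toEuclideanCLM_thresholdProj_eigenvectorBasis (j : Fin d) :
    Matrix.toEuclideanCLM (n := Fin d) (𝕜 := ℂ) (thresholdProj hA B) (hA.eigenvectorBasis j) =
      (if B ≤ hA.eigenvalues j then 1 else 0 : ℂ) • hA.eigenvectorBasis j := by
  apply (WithLp.equiv 2 _).injective
  simp only [WithLp.equiv_apply, Matrix.ofLp_toEuclideanCLM, thresholdProj_eq, WithLp.ofLp_smul]
  rw [← Matrix.mulVec_mulVec, ← Matrix.mulVec_mulVec, hA.star_eigenvectorUnitary_mulVec,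
    Matrix.diagonal_mulVec_single, mul_one]
  split_ifs
  · rw [hA.eigenvectorUnitary_mulVec, one_smul]
  · rw [Pi.single_zero, Matrix.mulVec_zero, zero_smul]

theorem inner_one_sub_thresholdProj (j : Fin d) (x : EuclideanSpace ℂ (Fin d)) :
    inner ℂ (hA.eigenvectorBasis j)
        (Matrix.toEuclideanCLM (n := Fin d) (𝕜 := ℂ) (1 - thresholdProj hA B) x) =
      if B ≤ hA.eigenvalues j then 0 else inner ℂ (hA.eigenvectorBasis j) x := by
  rw [← isSymmetric_toEuclideanCLM (Matrix.isHermitian_one.sub (isHermitian_thresholdProj hA B)),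
    map_sub, map_one, sub_apply, toEuclideanCLM_thresholdProj_eigenvectorBasis]
  split_ifs <;> simp

theorem quadForm_one_sub_thresholdProj_le (x : EuclideanSpace ℂ (Fin d)) :
    quadForm A (Matrix.toEuclideanCLM (n := Fin d) (𝕜 := ℂ) (1 - thresholdProj hA B) x) ≤
      B * ‖Matrix.toEuclideanCLM (n := Fin d) (𝕜 := ℂ) (1 - thresholdProj hA B) x‖ ^ 2 := by
  rw [quadForm_eq_sum hA, ← hA.eigenvectorBasis.sum_sq_norm_inner_right, Finset.mul_sum]
  refine Finset.sum_le_sum fun j _ => ?_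
  rw [inner_one_sub_thresholdProj]
  split_ifs with h
  · simp
  · exact mul_le_mul_of_nonneg_right (not_le.1 h).le (sq_nonneg _)

/-- The part of `ρ` below the threshold of an approximation `A` is small. -/
theorem opNorm_conj_one_sub_thresholdProj_le {ρ : Matrix (Fin d) (Fin d) ℂ} (hρ : ρ.PosSemidef)
    {δ : ℝ} (hB : 0 ≤ B) (hδ : 0 ≤ δ) (hop : opNorm (A - ρ) ≤ δ) :
    opNorm ((1 - thresholdProj hA B) * ρ * (1 - thresholdProj hA B)) ≤ B + δ := by
  have hQ : (1 - thresholdProj hA B).IsHermitian :=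
    Matrix.isHermitian_one.sub (isHermitian_thresholdProj hA B)
  have hherm : ((1 - thresholdProj hA B) * ρ * (1 - thresholdProj hA B)).IsHermitian := by
    rw [Matrix.IsHermitian, Matrix.conjTranspose_mul, Matrix.conjTranspose_mul, hQ.eq,
      hρ.isHermitian.eq, mul_assoc]
  refine opNorm_le_of_abs_quadForm_le hherm (by positivity) fun x hx => ?_
  rw [quadForm_conj hQ, abs_of_nonneg (quadForm_nonneg hρ _)]
  -- On the range of the complementary projector `A` is at most B, and ρ exceeds `A` by at most δ.
  have h1 := quadForm_one_sub_thresholdProj_le hA B x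
  have h2 := norm_sq_one_sub_toEuclideanCLM_le (isHermitian_thresholdProj hA B)
    (thresholdProj_mul_self hA B) x
  set y := Matrix.toEuclideanCLM (n := Fin d) (𝕜 := ℂ) (1 - thresholdProj hA B) x
  have h3 := (abs_le.1 (abs_quadForm_le (A - ρ) y)).1
  have h4 : opNorm (A - ρ) * ‖y‖ ^ 2 ≤ δ * ‖y‖ ^ 2 := by gcongr
  have h5 : (B + δ) * ‖y‖ ^ 2 ≤ B + δ := mul_le_of_le_one_right (by positivity) (by simpa [hx] using h2)
  rw [quadForm_sub] at h3
  linarith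

end Threshold

theorem opNorm_sub_comm (M N : Matrix (Fin d) (Fin d) ℂ) : opNorm (M - N) = opNorm (N - M) := by
  rw [opNorm, opNorm, map_sub, map_sub, norm_sub_rev]

end

/-! ### Rank and leading eigenvalues under perturbation. -/

section

variable {d : ℕ} {A ρ : Matrix (Fin d) (Fin d) ℂ}

theorem IsDensityMatrix.sum_spec_le_one (hρ : IsDensityMatrix ρ) (s : Finset (Fin d)) :
    ∑ i ∈ s, spec hρ.posSemidef.isHermitian i ≤ 1 := by
  have h : ∑ i, spec hρ.posSemidef.isHermitian i = 1 := by
    rw [sum_spec, hρ.trace_eq_one, Complex.one_re]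
  rw [← h]
  refine Finset.sum_le_sum_of_subset_of_nonneg (Finset.subset_univ _) fun i _ _ => ?_
  rw [spec_eq]
  exact hρ.posSemidef.eigenvalues_nonneg _

/-- Each eigenvalue of `A` above the threshold forces, by Weyl, an eigenvalue of ρ at least B - δ,
and those sum to at most 1. -/
theorem rank_thresholdProj_mul_le (hA : A.IsHermitian) (hρ : IsDensityMatrix ρ) {B δ : ℝ}
    (hop : opNorm (A - ρ) ≤ δ) : (thresholdProj hA B).rank * (B - δ) ≤ 1 := by
  rw [rank_thresholdProj, ← nsmul_eq_mul]
  refine (Finset.card_nsmul_le_sum _ (spec hρ.posSemidef.isHermitian) _ fun i hi => ?_).trans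
    (hρ.sum_spec_le_one _)
  have h1 := (abs_le.1 ((abs_spec_sub_le hA hρ.posSemidef.isHermitian i).trans hop)).2
  have h2 := (Finset.mem_filter.1 hi).2
  linarith

theorem dTV_firstEntries_spec_le {A' : Matrix (Fin d) (Fin d) ℂ} (hA : A.IsHermitian)
    (hA' : A'.IsHermitian) (r : ℕ) {δ : ℝ} (hop : opNorm (A - A') ≤ δ) :
    dTV (firstEntries r (spec hA)) (firstEntries r (spec hA')) ≤ 1 / 2 * (r * δ) := by
  have hδ : 0 ≤ δ := (norm_nonneg _).trans hop
  have hcard : Fintype.card {i : Fin d // (i : ℕ) < r} ≤ r := by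
    simpa using Fintype.card_le_of_injective
      (fun i : {i : Fin d // (i : ℕ) < r} => (⟨i.1, i.2⟩ : Fin r))
      fun i j h => Subtype.ext (Fin.ext (by simpa using h))
  rw [dTV]
  gcongr
  calc
    _ ≤ ∑ _i : {i : Fin d // (i : ℕ) < r}, δ :=
      Finset.sum_le_sum fun i _ => (abs_spec_sub_le hA hA' i.1).trans hop
    _ = Fintype.card {i : Fin d // (i : ℕ) < r} * δ := by simp
    _ ≤ r * δ := by gcongr

end

end UniformPOVM

/-! ### The main theorem: choice of constants. -/

theorem theorem6p1 :
    ∃ C : ℝ, 0 < C ∧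
      ∀ (d : ℕ) (ρ : Matrix (Fin d) (Fin d) ℂ) (hρ : UniformPOVM.IsDensityMatrix ρ)
        (B ε : ℝ), 0 < B → B ≤ 1 → 0 < ε → ε ≤ 1 →
      ∀ n : ℕ, C * d * B⁻¹ ^ 2 * ε⁻¹ ^ 2 ≤ n →
      ∃ E : Set (Fin n → UniformPOVM.PureState d), MeasurableSet E ∧
        (99 / 100 : ℝ≥0∞) ≤ UniformPOVM.uniformPOVMCopies ρ n E ∧
        ∀ u ∈ E,
          UniformPOVM.dTV
              (UniformPOVM.firstEntries (UniformPOVM.bucket B u).rank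
                (UniformPOVM.spec (UniformPOVM.isHermitian_estimate u)))
              (UniformPOVM.firstEntries (UniformPOVM.bucket B u).rank
                (UniformPOVM.spec hρ.posSemidef.isHermitian)) ≤ ε ∧
          ((UniformPOVM.bucket B u).rank : ℝ) ≤ 3 / (2 * B) ∧
          UniformPOVM.opNorm
              ((1 - UniformPOVM.bucket B u) * ρ * (1 - UniformPOVM.bucket B u)) ≤ (1 + ε) * B ∧
          UniformPOVM.dTV
              (UniformPOVM.spec (UniformPOVM.isHermitian_pinch
                (UniformPOVM.isHermitian_bucket B u) hρ.posSemidef.isHermitian))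
              (UniformPOVM.spec hρ.posSemidef.isHermitian) ≤ ε := by
  -- 12800 = 200 · 8²: the net argument runs at τ = Bε/8 and doubles it to δ = Bε/4.
  refine ⟨12800, by norm_num, fun d ρ hρ B ε hB hB1 hε hε1 n hn => ?_⟩
  have hBε : B * ε ≤ 1 := mul_le_one₀ hB1 hε.le hε1
  have hBεB : B * ε ≤ B := mul_le_of_le_one_right hB.le hε1
  obtain ⟨E, hE, hprob, hop⟩ := UniformPOVM.exists_opNorm_estimate_sub_le hρ (n := n)
    (τ := B * ε / 8) (by positivity) (by linarith) (by
      have h1 : 12800 * d * B⁻¹ ^ 2 * ε⁻¹ ^ 2 * (B * ε / 8) ^ 2 = 200 * d := by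
        field_simp
        ring
      rw [← h1]
      gcongr)
  refine ⟨E, hE, hprob, fun u hu => ?_⟩
  set δ := B * ε / 4 with hδdef
  have hδ : 0 < δ := by positivity
  have hopu : UniformPOVM.opNorm (UniformPOVM.estimate u - ρ) ≤ δ :=
    (hop u hu).trans_eq (by rw [hδdef]; ring)
  have hr : ((UniformPOVM.bucket B u).rank : ℝ) ≤ 3 / (2 * B) := by
    have h := UniformPOVM.rank_thresholdProj_mul_le (B := B) (UniformPOVM.isHermitian_estimate u)
      hρ hopu
    rw [le_div_iff₀ (by positivity)]
    -- ε ≤ 1 gives δ ≤ B/4, so B - δ ≥ 3B/4, more than the 2B/3 needed.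
    have h2 : ((UniformPOVM.bucket B u).rank : ℝ) * (2 / 3 * B) ≤
        (UniformPOVM.bucket B u).rank * (B - δ) := by
      gcongr
      linarith
    have h3 := h2.trans h
    linarith
  -- The two total variation bounds cost rδ/2 and 2rδ, hence at most 3ε/16 and 3ε/4.
  have hrδ : ((UniformPOVM.bucket B u).rank : ℝ) * δ ≤ 3 / 8 * ε := by
    calc
      _ ≤ 3 / (2 * B) * δ := by gcongr
      _ = _ := by rw [hδdef]; field_simp; norm_num
  refine ⟨?_, hr, ?_, ?_⟩
  · refine (UniformPOVM.dTV_firstEntries_spec_le _ _ _ hopu).trans ?_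
    linarith
  · refine (UniformPOVM.opNorm_conj_one_sub_thresholdProj_le
      (UniformPOVM.isHermitian_estimate u) B hρ.posSemidef hB.le hδ.le hopu).trans ?_
    rw [hδdef]
    linarith [mul_pos hB hε]
  · refine (UniformPOVM.dTV_spec_pinch_le (UniformPOVM.isHermitian_bucket B u)
      (UniformPOVM.thresholdProj_mul_self _ _) (UniformPOVM.thresholdProj_mul_comm _ _)
      hρ.posSemidef.isHermitian (UniformPOVM.isHermitian_estimate u) hδ
      (by rwa [UniformPOVM.opNorm_sub_comm])).trans ?_
    have htr : (UniformPOVM.bucket B u).trace.re = (UniformPOVM.bucket B u).rank := by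
      rw [UniformPOVM.bucket, UniformPOVM.trace_thresholdProj, Complex.natCast_re]
    rw [htr]
    linarith
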